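/- Theorem 1. A finite set $K\subseteq\mathbb{Z}^2$ is lattice-convex if $K=C\cap\mathbb{Z}^2$ for some convex $C\subseteq\mathbb{R}^2$; let $\mathcal{K}(\mathbb{Z}^2)$ be the class of finite lattice-convex sets $K\subseteq\mathbb{Z}^2$ whose affine hull is $\mathbb{R}^2$. For finite $K\subseteq\mathbb{Z}^2$ the covariogram is $g_K(u)=|K\cap(K+u)|$, $u\in\mathbb{Z}^2$. For $u\in\mathbb{Z}^2$ let $F(K,u)$ be the set of those $x\in K$ at which $\langle x,u\rangle$ attains its maximum over $K$, and let $$U(K)=\{u\in\mathbb{Z}^2\setminus\{o\} : \gcd(u)=1,\ |F(K,u)|>1\}$$ be the set of primitive outer normals to edges of $K$. With $\min\emptyset=\infty$, put $$m'(K)=\min\{|F(K,u)| : u\in U(K)\},$$ $$m''(K)=\min\{|F(K,u)|-|F(K,-u)|+1 : u\in\mathbb{Z}^2\setminus\{o\},\ |F(K,u)|>|F(K,-u)|>1\},$$ $$m(K)=\min\{m'(K),m''(K)\},\qquad \delta(K)=\frac{\max D(K)}{\min D(K)},\quad D(K)=\{|\det(u_1,u_2)| : u_1,u_2\in U(K)\}\setminus\{0\}.$$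 Finally let $[K]=\{K+t : t\in\mathbb{R}^2\}\cup\{-K+t : t\in\mathbb{R}^2\}$ be the set of all translations and point reflections of $K$. Let $K,L\in\mathcal{K}(\mathbb{Z}^2)$ satisfy $g_K=g_L$. Then $m'(K)$, $m''(K)$, $m(K)$, $U(K)\cup U(-K)$ and $\delta(K)$ are determined by $g_K$, that is, $m'(K)=m'(L)$, $m''(K)=m''(L)$, $m(K)=m(L)$, $U(K)\cup U(-K)=U(L)\cup U(-L)$ and $\delta(K)=\delta(L)$. Moreover, if $m(K)\ge\delta(K)^2+\delta(K)+1$, then $[K]=[L]$; that is, $L$ is a translate or a point reflection of $K$, so $g_K$ determines $K$ within $\mathcal{K}(\mathbb{Z}^2)$ up to translations and point reflections. -/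

import Mathlib

open scoped Pointwise NNReal ENNReal

namespace LatticeCovariogram

/-- The inclusion of the integer lattice `ℤ²` into the real plane `ℝ²`. -/
def toReal (x : ℤ × ℤ) : ℝ × ℝ := ((x.1 : ℝ), (x.2 : ℝ))

/-- `K` is lattice-convex: it is the intersection of `ℤ²` with a convex subset of `ℝ²`. -/
def IsLatticeConvex (K : Finset (ℤ × ℤ)) : Prop :=
  ∃ C : Set (ℝ × ℝ), Convex ℝ C ∧ ∀ x : ℤ × ℤ, x ∈ K ↔ toReal x ∈ C

/-- The class of finite lattice-convex subsets of `ℤ²` whose affine hull is the plane `ℝ²`. -/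
structure IsPlanarLatticeConvex (K : Finset (ℤ × ℤ)) : Prop where
  latticeConvex : IsLatticeConvex K
  affineSpan_eq_top : affineSpan ℝ (toReal '' (K : Set (ℤ × ℤ))) = ⊤

/-- The discrete covariogram `g_K : u ↦ |K ∩ (K + u)|`. -/
def covariogram (K : Finset (ℤ × ℤ)) (u : ℤ × ℤ) : ℕ :=
  (K ∩ K.image (fun x => x + u)).card

/-- The standard scalar product of integer vectors. -/
def dot (x u : ℤ × ℤ) : ℤ := x.1 * u.1 + x.2 * u.2

/-- The determinant of the matrix with columns `u` and `v`. -/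
def det (u v : ℤ × ℤ) : ℤ := u.1 * v.2 - v.1 * u.2

/-- The support set `F(K, u)`: the points of `K` at which `x ↦ ⟨x, u⟩` is maximal on `K`. -/
def supportSet (K : Finset (ℤ × ℤ)) (u : ℤ × ℤ) : Finset (ℤ × ℤ) :=
  K.filter (fun x => ∀ y ∈ K, dot y u ≤ dot x u)

/-- `U(K)`: the primitive integer vectors `u` that are outer normals to an edge of `K`, that is,
for which the support set `F(K, u)` has more than one element. -/
def edgeNormals (K : Finset (ℤ × ℤ)) : Set (ℤ × ℤ) :=
  {u | u ≠ 0 ∧ Int.gcd u.1 u.2 = 1 ∧ 1 < (supportSet K u).card}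

/-- `m'(K)`, the least number of lattice points on an edge of `K`. -/
noncomputable def mPrime (K : Finset (ℤ × ℤ)) : ℕ∞ :=
  sInf {n : ℕ∞ | ∃ u ∈ edgeNormals K, n = ((supportSet K u).card : ℕ∞)}

/-- `m''(K)`, the least value of `|F(K, u)| - |F(K, -u)| + 1` over all nonzero integer vectors `u`
with `|F(K, u)| > |F(K, -u)| > 1` (the natural-number subtraction is exact for these `u`);
it is `∞` if there is no such `u`. -/
noncomputable def mDoublePrime (K : Finset (ℤ × ℤ)) : ℕ∞ :=
  sInf {n : ℕ∞ | ∃ u : ℤ × ℤ, u ≠ 0 ∧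
    (supportSet K (-u)).card < (supportSet K u).card ∧ 1 < (supportSet K (-u)).card ∧
    n = (((supportSet K u).card - (supportSet K (-u)).card + 1 : ℕ) : ℕ∞)}

/-- `m(K) = min {m'(K), m''(K)}`. -/
noncomputable def m (K : Finset (ℤ × ℤ)) : ℕ∞ := min (mPrime K) (mDoublePrime K)

/-- `D(U) = {|det(u₁, u₂)| : u₁, u₂ ∈ U} \ {0}`. -/
def detSet (U : Set (ℤ × ℤ)) : Set ℕ :=
  {n | n ≠ 0 ∧ ∃ u₁ ∈ U, ∃ u₂ ∈ U, n = (det u₁ u₂).natAbs}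

/-- The discrepancy `max D(U) / min D(U)` of a finite set `U` of integer vectors that spans the
plane (for such `U` the set `D(U)` is finite and nonempty, so that the supremum and the infimum
are its maximum and its minimum). -/
noncomputable def setDiscrepancy (U : Set (ℤ × ℤ)) : ℝ≥0 :=
  ((sSup (detSet U) : ℕ) : ℝ≥0) / ((sInf (detSet U) : ℕ) : ℝ≥0)

/-- The discrepancy `δ(K) = δ(U(K))`. -/
noncomputable def discrepancy (K : Finset (ℤ × ℤ)) : ℝ≥0 := setDiscrepancy (edgeNormals K)

/-- `[S] = {S + t : t ∈ ℝ²} ∪ {-S + t : t ∈ ℝ²}`, the set of all translations and point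
reflections of `S ⊆ ℝ²`. -/
def translationReflectionClass (S : Set (ℝ × ℝ)) : Set (Set (ℝ × ℝ)) :=
  {T | ∃ t : ℝ × ℝ, T = (fun x => x + t) '' S} ∪ {T | ∃ t : ℝ × ℝ, T = (fun x => -x + t) '' S}

end LatticeCovariogram

/-! The covariogram determines the difference set `K - K`, hence the difference of opposite extreme
vertices, and it counts the pairs of points of `K` with a given difference. For a primitive
direction `u` this yields the sum of the lattice lengths of the faces with normals `u` and `-u`
(from the vertices of `K - K`) and the product of their cardinalities (from the pairs with maximal
difference), so the two lengths are known up to order (`len_eq_or_eq`). The five invariants depend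
on nothing else.

A lattice polygon is determined up to translation by its edge lengths in all directions, because
boundary chains are sums of edge vectors (`first_sub_last_eq_sum`). It remains to show that the
orders are consistent: all pairs appear in `L` as in `K`, or all are reversed
(`forall_len_eq_or_forall_len_eq`). If not, choose a direction `u` whose unequal pair is kept and a
direction `v` whose unequal pair is reversed, with as few directions as possible strictly between
them. By minimality every edge in between has the length of its opposite, in `K` and in `L`. After a
translation the boundary arc from `u` to `v` and the opposite arc are common to `K` and `L` and are
reflections of each other in a point. This is the situation of `IsSwitch`, with the edges `u` and
`v` of `K` longer than their opposites, which is achieved by point reflection and by exchanging `K`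
and `L`.

The contradiction has a local and a global part. Locally, a low cap of `K` at the short edge `-u`
can be translated under the longer edge `u`, so its cardinality is a value of the covariogram. If
the edges following `-u` in `K` and `L` had different directions, then on a suitable row the two
polygons would begin at least two lattice steps apart, and comparing caps excludes this
(`not_det_pos_of_isNext`). The row is reached by at most `δ + 1` steps along an edge, and the
lengths needed for everything to fit are at most `δ * (δ + 1)`; this is the source of the bound on
`m`. Hence the neighbours of `-u` agree in `K` and `L`, and likewise those of `-v` in `K` and in
`-L`.

Globally, for one well-chosen vector `x`, the set `K ∩ (K + x)` is mapped injectively, but not onto,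
into `L ∩ (L + x)`: a point stays where it is unless the edge of `L` following `v` cuts it off, in
which case it is reflected (`IsSwitch.elim`). This contradicts the equality of the covariograms at
`x`. -/

namespace LatticeCovariogram

/-! ### Planar integer vectors -/

/-- The counterclockwise rotation by a right angle. -/
def rot (u : ℤ × ℤ) : ℤ × ℤ := (-u.2, u.1)

theorem dot_add_left (x y u : ℤ × ℤ) : dot (x + y) u = dot x u + dot y u := by
  simp only [dot, Prod.fst_add, Prod.snd_add]; ring

theorem dot_sub_left (x y u : ℤ × ℤ) : dot (x - y) u = dot x u - dot y u := by
  simp only [dot, Prod.fst_sub, Prod.snd_sub]; ring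

theorem dot_neg_left (x u : ℤ × ℤ) : dot (-x) u = -dot x u := by
  simp only [dot, Prod.fst_neg, Prod.snd_neg]; ring

theorem dot_smul_left (k : ℤ) (x u : ℤ × ℤ) : dot (k • x) u = k * dot x u := by
  simp only [dot, Prod.smul_fst, Prod.smul_snd, smul_eq_mul]; ring

theorem dot_neg_right (x u : ℤ × ℤ) : dot x (-u) = -dot x u := by
  simp only [dot, Prod.fst_neg, Prod.snd_neg]; ring

theorem dot_add_right (x u v : ℤ × ℤ) : dot x (u + v) = dot x u + dot x v := by
  simp only [dot, Prod.fst_add, Prod.snd_add]; ring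

theorem dot_smul_right (k : ℤ) (x u : ℤ × ℤ) : dot x (k • u) = k * dot x u := by
  simp only [dot, Prod.smul_fst, Prod.smul_snd, smul_eq_mul]; ring

theorem dot_rot_left (u v : ℤ × ℤ) : dot (rot u) v = det u v := by
  simp only [dot, det, rot]; ring

theorem rot_neg (u : ℤ × ℤ) : rot (-u) = -rot u := by
  simp [rot]

theorem det_add_right (u x y : ℤ × ℤ) : det u (x + y) = det u x + det u y := by
  simp only [det, Prod.fst_add, Prod.snd_add]; ring

theorem det_sub_right (u x y : ℤ × ℤ) : det u (x - y) = det u x - det u y := by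
  simp only [det, Prod.fst_sub, Prod.snd_sub]; ring

theorem det_smul_right (k : ℤ) (u x : ℤ × ℤ) : det u (k • x) = k * det u x := by
  simp only [det, Prod.smul_fst, Prod.smul_snd, smul_eq_mul]; ring

theorem det_add_left (x y u : ℤ × ℤ) : det (x + y) u = det x u + det y u := by
  simp only [det, Prod.fst_add, Prod.snd_add]; ring

theorem det_smul_left (k : ℤ) (x u : ℤ × ℤ) : det (k • x) u = k * det x u := by
  simp only [det, Prod.smul_fst, Prod.smul_snd, smul_eq_mul]; ring

theorem det_neg_left (u v : ℤ × ℤ) : det (-u) v = -det u v := by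
  simp only [det, Prod.fst_neg, Prod.snd_neg]; ring

theorem det_neg_right (u v : ℤ × ℤ) : det u (-v) = -det u v := by
  simp only [det, Prod.fst_neg, Prod.snd_neg]; ring

theorem det_swap (u v : ℤ × ℤ) : det v u = -det u v := by
  simp only [det]; ring

theorem det_self (u : ℤ × ℤ) : det u u = 0 := by
  simp only [det]; ring

theorem det_rot_right (u v : ℤ × ℤ) : det u (rot v) = dot u v := by
  simp only [det, dot, rot]; ring

theorem dot_self_pos {u : ℤ × ℤ} (hu : u ≠ 0) : 0 < dot u u := by
  have : u.1 ≠ 0 ∨ u.2 ≠ 0 := by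
    by_contra h
    push Not at h
    exact hu (Prod.ext h.1 h.2)
  simp only [dot]
  rcases this with h | h
  · have := mul_self_pos.2 h
    nlinarith [mul_self_nonneg u.2]
  · have := mul_self_pos.2 h
    nlinarith [mul_self_nonneg u.1]

/-- The Plücker relation between a scalar product and three determinants. -/
theorem dot_mul_det (z u v w : ℤ × ℤ) :
    dot z w * det u v = dot z u * det w v + dot z v * det u w := by
  simp only [dot, det]; ring

theorem det_mul_det (z u v w : ℤ × ℤ) :
    det z w * det u v = det z u * det w v + det z v * det u w := by
  simp only [det]; ring

/-- The direction `w` lies in the cone spanned by `u` and `v`. -/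
theorem dot_le_of_arc {u v w z y : ℤ × ℤ} (huv : 0 < det u v) (huw : 0 ≤ det u w)
    (hwv : 0 ≤ det w v) (hu : dot z u ≤ dot y u) (hv : dot z v ≤ dot y v) :
    dot z w ≤ dot y w := by
  have h1 := dot_mul_det z u v w
  have h2 := dot_mul_det y u v w
  have h3 : dot z w * det u v ≤ dot y w * det u v := by
    rw [h1, h2]
    exact add_le_add (mul_le_mul_of_nonneg_right hu hwv) (mul_le_mul_of_nonneg_right hv huw)
  exact le_of_mul_le_mul_right h3 huv

theorem exists_smul_rot {d u : ℤ × ℤ} (hu : Int.gcd u.1 u.2 = 1) (h : dot d u = 0) :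
    ∃ k : ℤ, d = k • rot u := by
  have hc : IsCoprime u.1 u.2 := Int.isCoprime_iff_gcd_eq_one.2 hu
  obtain ⟨a, b, hab⟩ := hc
  -- The functional `x ↦ a * x.2 - b * x.1` built from the Bézout coefficients takes the value 1 on
  -- `rot u`, so its value on `d` is the multiple sought.
  refine ⟨a * d.2 - b * d.1, Prod.ext ?_ ?_⟩
  · simp only [rot, Prod.smul_fst, smul_eq_mul]
    simp only [dot] at h
    linear_combination (-d.1) * hab + a * h
  · simp only [rot, Prod.smul_snd, smul_eq_mul]
    simp only [dot] at h
    linear_combination (-d.2) * hab + b * h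

theorem ne_zero_of_gcd {u : ℤ × ℤ} (hu : Int.gcd u.1 u.2 = 1) : u ≠ 0 := by
  rintro rfl
  simp at hu

theorem gcd_neg {u : ℤ × ℤ} (hu : Int.gcd u.1 u.2 = 1) : Int.gcd (-u).1 (-u).2 = 1 := by
  simpa using hu

theorem exists_primitive {w : ℤ × ℤ} (hw : w ≠ 0) :
    ∃ (k : ℤ) (v : ℤ × ℤ), 0 < k ∧ w = k • v ∧ Int.gcd v.1 v.2 = 1 := by
  have hpos : 0 < Int.gcd w.1 w.2 := by
    rw [Int.gcd_pos_iff]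
    by_contra h
    push Not at h
    exact hw (Prod.ext h.1 h.2)
  obtain ⟨a, b, hab, h1, h2⟩ := Int.exists_gcd_one hpos
  refine ⟨Int.gcd w.1 w.2, (a, b), by exact_mod_cast hpos, Prod.ext ?_ ?_, hab⟩
  · simp only [Prod.smul_fst, smul_eq_mul]; linarith
  · simp only [Prod.smul_snd, smul_eq_mul]; linarith

/-- Parallel primitive vectors are equal or opposite. -/
theorem eq_or_eq_neg_of_det_eq_zero {u v : ℤ × ℤ} (hu : Int.gcd u.1 u.2 = 1)
    (hv : Int.gcd v.1 v.2 = 1) (h : det u v = 0) : v = u ∨ v = -u := by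
  have hd : dot (rot v) u = 0 := by rw [dot_rot_left, det_swap, h, neg_zero]
  obtain ⟨k, hk⟩ := exists_smul_rot hu hd
  have h1 : v = k • u := by
    have := congrArg Prod.fst hk
    have h2 := congrArg Prod.snd hk
    simp [rot] at this h2
    exact Prod.ext (by simpa using h2) (by simpa using this)
  have hk1 : k.natAbs = 1 := by
    rw [h1] at hv
    simp only [Prod.smul_fst, Prod.smul_snd, smul_eq_mul, Int.gcd_mul_left, hu, mul_one] at hv
    exact hv
  rcases Int.natAbs_eq k with h | h <;> rw [hk1] at h
  · left; rw [h1, h]; simp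
  · right; rw [h1, h]; simp

/-- `det (u, w) > 0` and `det (w, v) > 0` for `w` in the open arc from `u` to `v` of length
less than `π`. -/
theorem det_pos_of_between {u v w x : ℤ × ℤ} (hvw : 0 < det v w) (hvx : 0 < det v x)
    (hxw : 0 ≤ det x w) (huv : 0 < det u v) (huw : 0 < det u w) : 0 < det u x := by
  have h := det_mul_det u v w x
  have : 0 < det u x * det v w := by
    rw [h]
    have h1 := mul_nonneg huv.le hxw
    have h2 := mul_pos huw hvx
    linarith
  exact pos_of_mul_pos_left this hvw.le

/-! ### First and last points of faces -/

/-- `p` is the first point of the face of `K` with outer normal `u`, in counterclockwise order. -/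
def IsFirst (K : Finset (ℤ × ℤ)) (u p : ℤ × ℤ) : Prop :=
  p ∈ supportSet K u ∧ ∀ y ∈ supportSet K u, det u p ≤ det u y

/-- `p` is the last point of the face of `K` with outer normal `u`, in counterclockwise order. -/
def IsLast (K : Finset (ℤ × ℤ)) (u p : ℤ × ℤ) : Prop :=
  p ∈ supportSet K u ∧ ∀ y ∈ supportSet K u, det u y ≤ det u p

theorem mem_supportSet {K : Finset (ℤ × ℤ)} {u p : ℤ × ℤ} :
    p ∈ supportSet K u ↔ p ∈ K ∧ ∀ y ∈ K, dot y u ≤ dot p u := by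
  simp [supportSet]

theorem supportSet_nonempty {K : Finset (ℤ × ℤ)} (hK : K.Nonempty) (u : ℤ × ℤ) :
    (supportSet K u).Nonempty := by
  obtain ⟨p, hp, h⟩ := K.exists_max_image (fun x => dot x u) hK
  exact ⟨p, mem_supportSet.2 ⟨hp, h⟩⟩

theorem exists_isFirst {K : Finset (ℤ × ℤ)} (hK : K.Nonempty) (u : ℤ × ℤ) :
    ∃ p, IsFirst K u p := by
  obtain ⟨p, hp, h⟩ := (supportSet K u).exists_min_image (det u) (supportSet_nonempty hK u)
  exact ⟨p, hp, h⟩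

theorem exists_isLast {K : Finset (ℤ × ℤ)} (hK : K.Nonempty) (u : ℤ × ℤ) :
    ∃ p, IsLast K u p := by
  obtain ⟨p, hp, h⟩ := (supportSet K u).exists_max_image (det u) (supportSet_nonempty hK u)
  exact ⟨p, hp, h⟩

section faces

variable {K : Finset (ℤ × ℤ)} {u p q : ℤ × ℤ}

theorem IsFirst.mem (h : IsFirst K u p) : p ∈ K := (mem_supportSet.1 h.1).1

theorem IsLast.mem (h : IsLast K u p) : p ∈ K := (mem_supportSet.1 h.1).1

theorem IsFirst.dot_le (h : IsFirst K u p) {y : ℤ × ℤ} (hy : y ∈ K) : dot y u ≤ dot p u :=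
  (mem_supportSet.1 h.1).2 y hy

theorem IsLast.dot_le (h : IsLast K u p) {y : ℤ × ℤ} (hy : y ∈ K) : dot y u ≤ dot p u :=
  (mem_supportSet.1 h.1).2 y hy

theorem mem_supportSet_of_dot_eq (hp : p ∈ supportSet K u) (hq : q ∈ K) (h : dot q u = dot p u) :
    q ∈ supportSet K u :=
  mem_supportSet.2 ⟨hq, fun y hy => h ▸ (mem_supportSet.1 hp).2 y hy⟩

theorem dot_eq_of_mem_supportSet (hp : p ∈ supportSet K u) (hq : q ∈ supportSet K u) :
    dot p u = dot q u :=
  le_antisymm ((mem_supportSet.1 hq).2 p (mem_supportSet.1 hp).1)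
    ((mem_supportSet.1 hp).2 q (mem_supportSet.1 hq).1)

theorem eq_of_dot_eq_of_det_eq (hu : u ≠ 0) (h1 : dot p u = dot q u) (h2 : det u p = det u q) :
    p = q := by
  have h3 := dot_self_pos hu
  simp only [dot, det] at h1 h2 h3
  refine Prod.ext ?_ ?_
  · refine mul_right_cancel₀ h3.ne' ?_
    linear_combination u.1 * h1 - u.2 * h2
  · refine mul_right_cancel₀ h3.ne' ?_
    linear_combination u.2 * h1 + u.1 * h2

theorem IsFirst.unique (hu : u ≠ 0) (hp : IsFirst K u p) (hq : IsFirst K u q) : p = q :=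
  eq_of_dot_eq_of_det_eq hu (dot_eq_of_mem_supportSet hp.1 hq.1)
    (le_antisymm (hp.2 q hq.1) (hq.2 p hp.1))

end faces

/-! ### Lattice polygons -/

/-- A finite set of lattice points that is cut out by its supporting half-planes and has
positive width in every direction. -/
structure IsLatticePolygon (K : Finset (ℤ × ℤ)) : Prop where
  mem_of_forall : ∀ z, (∀ u, ∃ y ∈ K, dot z u ≤ dot y u) → z ∈ K
  exists_dot_lt : ∀ u, u ≠ 0 → ∃ x ∈ K, ∃ y ∈ K, dot x u < dot y u

theorem IsLatticePolygon.nonempty {K : Finset (ℤ × ℤ)} (hK : IsLatticePolygon K) : K.Nonempty := by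
  obtain ⟨x, hx, -⟩ := hK.exists_dot_lt (1, 0) (by simp)
  exact ⟨x, hx⟩

/-- The lattice length of the face with outer normal `u`. -/
def len (K : Finset (ℤ × ℤ)) (u : ℤ × ℤ) : ℤ := (supportSet K u).card - 1

theorem mem_of_between {K : Finset (ℤ × ℤ)} (hK : IsLatticePolygon K) {p d : ℤ × ℤ} {i n : ℤ}
    (hp : p ∈ K) (hq : p + n • d ∈ K) (h0 : 0 ≤ i) (hn : i ≤ n) : p + i • d ∈ K := by
  refine hK.mem_of_forall _ fun u => ?_
  rcases le_total (dot d u) 0 with h | h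
  · refine ⟨p, hp, ?_⟩
    rw [dot_add_left, dot_smul_left]
    nlinarith
  · refine ⟨_, hq, ?_⟩
    rw [dot_add_left, dot_add_left, dot_smul_left, dot_smul_left]
    nlinarith

theorem supportSet_eq_image {K : Finset (ℤ × ℤ)} (hK : IsLatticePolygon K) {u p q : ℤ × ℤ}
    (hu : Int.gcd u.1 u.2 = 1) (hp : IsFirst K u p) (hq : IsLast K u q) :
    ∃ n : ℕ, q = p + (n : ℤ) • rot u ∧
      supportSet K u = (Finset.range (n + 1)).image (fun i : ℕ => p + (i : ℤ) • rot u) := by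
  have hu0 := dot_self_pos (ne_zero_of_gcd hu)
  have key : ∀ z ∈ supportSet K u, ∃ i : ℤ, z = p + i • rot u := fun z hz => by
    obtain ⟨k, hk⟩ := exists_smul_rot (d := z - p) hu
      (by rw [dot_sub_left, dot_eq_of_mem_supportSet hz hp.1, sub_self])
    exact ⟨k, by rw [← hk]; abel⟩
  have hdet : ∀ i : ℤ, det u (p + i • rot u) = det u p + i * dot u u := fun i => by
    rw [det_add_right, det_smul_right, det_rot_right]
  obtain ⟨n, hn⟩ := key q hq.1
  have hn0 : 0 ≤ n := by
    have := hp.2 q hq.1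
    rw [hn, hdet] at this
    by_contra hneg
    nlinarith
  lift n to ℕ using hn0
  refine ⟨n, hn, ?_⟩
  ext z
  simp only [Finset.mem_image, Finset.mem_range]
  constructor
  · intro hz
    obtain ⟨i, rfl⟩ := key z hz
    have h1 := hp.2 _ hz
    have h2 := hq.2 _ hz
    rw [hdet] at h1
    rw [hn, hdet, hdet] at h2
    have hi0 : 0 ≤ i := by
      by_contra hneg
      nlinarith
    have hin : i ≤ n := by
      by_contra hneg
      nlinarith
    lift i to ℕ using hi0
    exact ⟨i, by omega, rfl⟩
  · rintro ⟨i, hi, rfl⟩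
    refine mem_supportSet_of_dot_eq hp.1 ?_ ?_
    · exact mem_of_between hK hp.mem (hn ▸ hq.mem) (by positivity) (by omega : (i : ℤ) ≤ n)
    · rw [dot_add_left, dot_smul_left, dot_rot_left, det_self, mul_zero, add_zero]

theorem smul_rot_injective {u : ℤ × ℤ} (hu : u ≠ 0) {i j : ℤ} (h : i • rot u = j • rot u) :
    i = j := by
  have h0 := dot_self_pos hu
  have := congrArg (det u) h
  rw [det_smul_right, det_smul_right, det_rot_right] at this
  exact mul_right_cancel₀ h0.ne' this

section edges

variable {K : Finset (ℤ × ℤ)} {u p q : ℤ × ℤ}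

theorem last_eq_first_add (hK : IsLatticePolygon K) (hu : Int.gcd u.1 u.2 = 1)
    (hp : IsFirst K u p) (hq : IsLast K u q) : q = p + len K u • rot u := by
  obtain ⟨n, hn, h⟩ := supportSet_eq_image hK hu hp hq
  have hc : (supportSet K u).card = n + 1 := by
    rw [h, Finset.card_image_of_injective, Finset.card_range]
    intro i j hij
    have := smul_rot_injective (ne_zero_of_gcd hu) (add_left_cancel hij)
    exact_mod_cast this
  rw [hn, len, hc]
  simp

theorem len_nonneg (hK : IsLatticePolygon K) : 0 ≤ len K u := by
  have := (supportSet_nonempty hK.nonempty u).card_pos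
  unfold len
  omega

theorem IsFirst.add_mem (hK : IsLatticePolygon K) (hu : Int.gcd u.1 u.2 = 1)
    (hp : IsFirst K u p) {i : ℤ} (h0 : 0 ≤ i) (hi : i ≤ len K u) : p + i • rot u ∈ K := by
  obtain ⟨q, hq⟩ := exists_isLast hK.nonempty u
  exact mem_of_between hK hp.mem (last_eq_first_add hK hu hp hq ▸ hq.mem) h0 hi

theorem IsLast.sub_mem (hK : IsLatticePolygon K) (hu : Int.gcd u.1 u.2 = 1)
    (hq : IsLast K u q) {i : ℤ} (h0 : 0 ≤ i) (hi : i ≤ len K u) : q - i • rot u ∈ K := by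
  obtain ⟨p, hp⟩ := exists_isFirst hK.nonempty u
  have := hp.add_mem hK hu (i := len K u - i) (by omega) (by omega)
  rwa [sub_smul, ← add_sub_assoc, ← last_eq_first_add hK hu hp hq] at this

theorem len_pos_iff : 0 < len K u ↔ 1 < (supportSet K u).card := by
  unfold len; omega

theorem mem_edgeNormals : u ∈ edgeNormals K ↔ Int.gcd u.1 u.2 = 1 ∧ 0 < len K u := by
  rw [len_pos_iff]
  exact ⟨fun h => h.2, fun h => ⟨ne_zero_of_gcd h.1, h⟩⟩

theorem mem_edgeNormals_of_ne (hu : Int.gcd u.1 u.2 = 1) (hp : p ∈ supportSet K u)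
    (hq : q ∈ supportSet K u) (h : p ≠ q) : u ∈ edgeNormals K :=
  ⟨ne_zero_of_gcd hu, hu, Finset.one_lt_card.2 ⟨p, hp, q, hq, h⟩⟩

end edges

/-! ### Sweeping from one normal direction to another -/

theorem supportSet_smul {K : Finset (ℤ × ℤ)} {k : ℤ} (hk : 0 < k) (u : ℤ × ℤ) :
    supportSet K (k • u) = supportSet K u := by
  ext p
  simp only [mem_supportSet, dot_smul_right, mul_le_mul_iff_right₀ hk]

/-- If no edge normal lies strictly between `u` and `v`, then the faces with normals `u` and `v`
meet at a vertex. -/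
theorem IsLast.isFirst_of_no_edge {K : Finset (ℤ × ℤ)} {u v p : ℤ × ℤ} (hp : IsLast K u p)
    (huv : 0 < det u v) (h : ∀ w ∈ edgeNormals K, 0 < det u w → ¬ 0 < det w v) :
    IsFirst K v p := by
  have hu : u ≠ 0 := by
    rintro rfl
    simp [det] at huv
  have hu0 := dot_self_pos hu
  have hmax : ∀ y ∈ K, dot y v ≤ dot p v := by
    by_contra hcon
    push Not at hcon
    obtain ⟨y₀, hy₀, hlt₀⟩ := hcon
    have hneg : ∀ y ∈ K, dot p v < dot y v → dot y u < dot p u := fun y hy hlt => by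
      refine lt_of_le_of_ne (hp.dot_le hy) fun heq => ?_
      have h1 := hp.2 y (mem_supportSet_of_dot_eq hp.1 hy heq)
      have h2 : dot (y - p) v * dot u u = dot (y - p) u * dot u v + det u (y - p) * det u v := by
        simp only [dot, det]; ring
      rw [dot_sub_left, dot_sub_left, det_sub_right, heq] at h2
      nlinarith
    -- Rotate the supporting line from `u` towards `v` until it first hits another point: this is
    -- the `y` with the largest ratio of gain in `v` to loss in `u`. The direction `B • u + A • v`
    -- then supports `K` at both `p` and `y`, so it is an edge normal strictly between `u` and `v`.
    obtain ⟨y, hy, hymax⟩ := (K.filter (fun y => dot p v < dot y v)).exists_max_image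
      (fun y => ((dot (y - p) v : ℤ) : ℚ) / (dot (p - y) u : ℤ)) ⟨y₀, by simp [hy₀, hlt₀]⟩
    rw [Finset.mem_filter] at hy
    have hB : 0 < dot (y - p) v := by rw [dot_sub_left]; linarith [hy.2]
    have hA : 0 < dot (p - y) u := by rw [dot_sub_left]; linarith [hneg y hy.1 hy.2]
    set A := dot (p - y) u with hAdef
    set B := dot (y - p) v with hBdef
    have hle : ∀ y' ∈ K, dot (y' - p) (B • u + A • v) ≤ 0 := fun y' hy' => by
      rw [dot_add_right, dot_smul_right, dot_smul_right]
      have hu' : dot (y' - p) u ≤ 0 := by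
        rw [dot_sub_left]; linarith [hp.dot_le hy']
      rcases le_or_gt (dot (y' - p) v) 0 with h0 | h0
      · nlinarith
      · have hlt' : dot p v < dot y' v := by rw [dot_sub_left] at h0; linarith
        have hA' : 0 < dot (p - y') u := by
          rw [dot_sub_left]; linarith [hneg y' hy' hlt']
        have := hymax y' (by simp [hy', hlt'])
        rw [div_le_div_iff₀ (by exact_mod_cast hA') (by exact_mod_cast hA)] at this
        have h3 : dot (y' - p) v * A ≤ B * dot (p - y') u := by exact_mod_cast this
        have h4 : dot (p - y') u = - dot (y' - p) u := by
          rw [← dot_neg_left, neg_sub]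
        rw [h4] at h3
        linarith
    have huw : det u (B • u + A • v) = A * det u v := by
      rw [det_add_right, det_smul_right, det_smul_right, det_self]; ring
    have hwv : det (B • u + A • v) v = B * det u v := by
      rw [det_add_left, det_smul_left, det_smul_left, det_self]; ring
    have hw0 : B • u + A • v ≠ 0 := by
      intro h0
      rw [h0] at huw
      have : det u 0 = 0 := by simp [det]
      rw [this] at huw
      have := mul_pos hA huv
      omega
    have hzero : dot (y - p) (B • u + A • v) = 0 := by
      rw [dot_add_right, dot_smul_right, dot_smul_right, ← hBdef]
      have h4 : dot (y - p) u = - A := by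
        rw [hAdef, ← dot_neg_left, neg_sub]
      rw [h4]; ring
    obtain ⟨k, w, hk, hw, hprim⟩ := exists_primitive hw0
    have hpw : p ∈ supportSet K w := by
      rw [← supportSet_smul hk w, ← hw]
      refine mem_supportSet.2 ⟨hp.mem, fun y' hy' => ?_⟩
      have := hle y' hy'
      rw [dot_sub_left] at this
      linarith
    have hyw : y ∈ supportSet K w := by
      rw [← supportSet_smul hk w, ← hw]
      refine mem_supportSet.2 ⟨hy.1, fun y' hy' => ?_⟩
      have h1 := hle y' hy'
      have h2 := hzero
      rw [dot_sub_left] at h1 h2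
      linarith
    have hne : p ≠ y := by
      rintro rfl
      exact lt_irrefl _ hy.2
    have hwe := mem_edgeNormals_of_ne hprim hpw hyw hne
    rw [hw, det_smul_right] at huw
    rw [hw, det_smul_left] at hwv
    refine h w hwe ?_ ?_
    · have : 0 < k * det u w := by rw [huw]; exact mul_pos hA huv
      exact pos_of_mul_pos_right this hk.le
    · have : 0 < k * det w v := by rw [hwv]; exact mul_pos hB huv
      exact pos_of_mul_pos_right this hk.le
  have hps : p ∈ supportSet K v := mem_supportSet.2 ⟨hp.mem, hmax⟩
  refine ⟨hps, fun y hy => ?_⟩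
  by_contra hlt
  push Not at hlt
  have heq := dot_eq_of_mem_supportSet hy hps
  have h1 := hp.dot_le (mem_supportSet.1 hy).1
  have hv0 : v ≠ 0 := by
    rintro rfl
    simp [det] at huv
  have hv := dot_self_pos hv0
  have h2 : dot (y - p) u * dot v v = dot (y - p) v * dot u v - det v (y - p) * det u v := by
    simp only [dot, det]; ring
  rw [dot_sub_left, dot_sub_left, det_sub_right, heq] at h2
  nlinarith

/-! ### Mirror images, point reflections and translates -/

/-- The reflection that interchanges the coordinates. -/
def mir (x : ℤ × ℤ) : ℤ × ℤ := (x.2, x.1)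

theorem mir_mir (x : ℤ × ℤ) : mir (mir x) = x := rfl

theorem dot_mir (x u : ℤ × ℤ) : dot (mir x) (mir u) = dot x u := by
  simp only [dot, mir]; ring

theorem det_mir (x u : ℤ × ℤ) : det (mir x) (mir u) = -det x u := by
  simp only [det, mir]; ring

theorem gcd_mir {u : ℤ × ℤ} (hu : Int.gcd u.1 u.2 = 1) : Int.gcd (mir u).1 (mir u).2 = 1 := by
  simpa [mir, Int.gcd_comm] using hu

theorem mir_injective : Function.Injective mir := fun x y h => by
  rw [← mir_mir x, h, mir_mir]

/-- The mirror image of a finite set of lattice points. -/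
def mirror (K : Finset (ℤ × ℤ)) : Finset (ℤ × ℤ) := K.image mir

theorem mem_mirror {K : Finset (ℤ × ℤ)} {x : ℤ × ℤ} : x ∈ mirror K ↔ mir x ∈ K := by
  simp only [mirror, Finset.mem_image]
  exact ⟨by rintro ⟨y, hy, rfl⟩; exact hy, fun h => ⟨_, h, mir_mir x⟩⟩

theorem mem_supportSet_mirror {K : Finset (ℤ × ℤ)} {u x : ℤ × ℤ} :
    x ∈ supportSet (mirror K) u ↔ mir x ∈ supportSet K (mir u) := by
  simp only [mem_supportSet, mem_mirror, dot_mir]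
  refine and_congr_right fun _ => ⟨fun h y hy => ?_, fun h y hy => ?_⟩
  · have := h (mir y) hy
    rwa [← dot_mir, mir_mir] at this
  · rw [← dot_mir]
    exact h (mir y) hy

theorem len_mirror (K : Finset (ℤ × ℤ)) (u : ℤ × ℤ) : len (mirror K) u = len K (mir u) := by
  have : supportSet (mirror K) u = (supportSet K (mir u)).image mir := by
    ext x
    rw [mem_supportSet_mirror, Finset.mem_image]
    exact ⟨fun h => ⟨_, h, mir_mir x⟩, by rintro ⟨y, hy, rfl⟩; exact hy⟩
  rw [len, len, this, Finset.card_image_of_injective _ mir_injective]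

theorem mem_edgeNormals_mirror {K : Finset (ℤ × ℤ)} {u : ℤ × ℤ} :
    u ∈ edgeNormals (mirror K) ↔ mir u ∈ edgeNormals K := by
  rw [mem_edgeNormals, mem_edgeNormals, len_mirror]
  simp [mir, Int.gcd_comm]

theorem IsLatticePolygon.mirror {K : Finset (ℤ × ℤ)} (hK : IsLatticePolygon K) :
    IsLatticePolygon (mirror K) where
  mem_of_forall z h := by
    refine mem_mirror.2 (hK.mem_of_forall _ fun u => ?_)
    obtain ⟨y, hy, hle⟩ := h (mir u)
    refine ⟨mir y, mem_mirror.1 hy, ?_⟩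
    rwa [← dot_mir, ← dot_mir (mir y)]
  exists_dot_lt u hu := by
    obtain ⟨x, hx, y, hy, h⟩ := hK.exists_dot_lt (mir u)
      (fun h0 => hu (mir_injective (by rw [h0]; rfl)))
    refine ⟨mir x, mem_mirror.2 hx, mir y, mem_mirror.2 hy, ?_⟩
    rwa [← dot_mir, ← dot_mir (mir y)]

/-- A mirror image reverses orientation and thus exchanges first with last and next with previous;
one half of each pair of symmetric statements follows from the other in this way. -/
theorem IsFirst.mirror {K : Finset (ℤ × ℤ)} {u p : ℤ × ℤ} (h : IsFirst K u p) :
    IsLast (mirror K) (mir u) (mir p) := by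
  refine ⟨by rw [mem_supportSet_mirror]; exact h.1, fun y hy => ?_⟩
  have h3 := mem_supportSet_mirror.1 hy
  rw [mir_mir] at h3
  have h1 := det_mir u p
  have h2 := det_mir u (mir y)
  rw [mir_mir] at h2
  rw [h1, h2]
  exact neg_le_neg (h.2 _ h3)

theorem mem_supportSet_neg {K : Finset (ℤ × ℤ)} {u x : ℤ × ℤ} :
    x ∈ supportSet (-K) u ↔ -x ∈ supportSet K (-u) := by
  simp only [mem_supportSet, Finset.mem_neg', dot_neg_left, dot_neg_right, neg_neg]
  refine and_congr_right fun _ => ⟨fun h y hy => ?_, fun h y hy => ?_⟩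
  · have := h (-y) (by rwa [neg_neg])
    rw [dot_neg_left] at this
    linarith
  · have := h (-y) hy
    rw [dot_neg_left] at this
    linarith

theorem card_supportSet_neg (K : Finset (ℤ × ℤ)) (u : ℤ × ℤ) :
    (supportSet (-K) u).card = (supportSet K (-u)).card := by
  have : supportSet (-K) u = -supportSet K (-u) := by
    ext x
    rw [mem_supportSet_neg, Finset.mem_neg']
  rw [this, Finset.card_neg]

theorem len_neg (K : Finset (ℤ × ℤ)) (u : ℤ × ℤ) : len (-K) u = len K (-u) := by
  rw [len, len, card_supportSet_neg]

theorem mem_edgeNormals_neg {K : Finset (ℤ × ℤ)} {u : ℤ × ℤ} :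
    u ∈ edgeNormals (-K) ↔ -u ∈ edgeNormals K := by
  rw [mem_edgeNormals, mem_edgeNormals, len_neg]
  simp

theorem IsLatticePolygon.neg {K : Finset (ℤ × ℤ)} (hK : IsLatticePolygon K) :
    IsLatticePolygon (-K) where
  mem_of_forall z h := by
    refine Finset.mem_neg'.2 (hK.mem_of_forall _ fun u => ?_)
    obtain ⟨y, hy, hle⟩ := h (-u)
    refine ⟨-y, Finset.mem_neg'.1 hy, ?_⟩
    simp only [dot_neg_left, dot_neg_right] at hle ⊢
    linarith
  exists_dot_lt u hu := by
    obtain ⟨x, hx, y, hy, h⟩ := hK.exists_dot_lt u hu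
    refine ⟨-y, by simpa, -x, by simpa, ?_⟩
    simp only [dot_neg_left]
    linarith

theorem IsFirst.neg {K : Finset (ℤ × ℤ)} {u p : ℤ × ℤ} (h : IsFirst K u p) :
    IsFirst (-K) (-u) (-p) := by
  refine ⟨mem_supportSet_neg.2 (by simpa using h.1), fun y hy => ?_⟩
  have := h.2 _ (by simpa using mem_supportSet_neg.1 hy)
  simp only [det_neg_left, det_neg_right] at this ⊢
  linarith

theorem IsLast.neg {K : Finset (ℤ × ℤ)} {u p : ℤ × ℤ} (h : IsLast K u p) :
    IsLast (-K) (-u) (-p) := by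
  refine ⟨mem_supportSet_neg.2 (by simpa using h.1), fun y hy => ?_⟩
  have := h.2 _ (by simpa using mem_supportSet_neg.1 hy)
  simp only [det_neg_left, det_neg_right] at this ⊢
  linarith

/-- The translate `K + t`. -/
def shift (t : ℤ × ℤ) (K : Finset (ℤ × ℤ)) : Finset (ℤ × ℤ) := K.image (fun x => x + t)

theorem mem_shift {t x : ℤ × ℤ} {K : Finset (ℤ × ℤ)} : x ∈ shift t K ↔ x - t ∈ K := by
  simp only [shift, Finset.mem_image]
  exact ⟨by rintro ⟨y, hy, rfl⟩; simpa using hy, fun h => ⟨_, h, by abel⟩⟩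

theorem mem_supportSet_shift {K : Finset (ℤ × ℤ)} {t u x : ℤ × ℤ} :
    x ∈ supportSet (shift t K) u ↔ x - t ∈ supportSet K u := by
  simp only [mem_supportSet, mem_shift]
  refine and_congr_right fun _ => ⟨fun h y hy => ?_, fun h y hy => ?_⟩
  · have := h (y + t) (by simpa using hy)
    rw [dot_add_left] at this
    rw [dot_sub_left]
    linarith
  · have := h _ hy
    rw [dot_sub_left, dot_sub_left] at this
    linarith

theorem len_shift (K : Finset (ℤ × ℤ)) (t u : ℤ × ℤ) : len (shift t K) u = len K u := by
  have : supportSet (shift t K) u = (supportSet K u).image (fun x => x + t) := by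
    ext x
    rw [mem_supportSet_shift, Finset.mem_image]
    exact ⟨fun h => ⟨_, h, by abel⟩, by rintro ⟨y, hy, rfl⟩; simpa using hy⟩
  rw [len, len, this, Finset.card_image_of_injective _ (add_left_injective t)]

theorem edgeNormals_shift (K : Finset (ℤ × ℤ)) (t : ℤ × ℤ) :
    edgeNormals (shift t K) = edgeNormals K := by
  ext u
  rw [mem_edgeNormals, mem_edgeNormals, len_shift]

theorem IsLatticePolygon.shift {K : Finset (ℤ × ℤ)} (hK : IsLatticePolygon K) (t : ℤ × ℤ) :
    IsLatticePolygon (shift t K) where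
  mem_of_forall z h := by
    refine mem_shift.2 (hK.mem_of_forall _ fun u => ?_)
    obtain ⟨y, hy, hle⟩ := h u
    refine ⟨y - t, mem_shift.1 hy, ?_⟩
    rw [dot_sub_left, dot_sub_left]
    linarith
  exists_dot_lt u hu := by
    obtain ⟨x, hx, y, hy, h⟩ := hK.exists_dot_lt u hu
    refine ⟨x + t, mem_shift.2 (by simpa), y + t, mem_shift.2 (by simpa), ?_⟩
    rw [dot_add_left, dot_add_left]
    linarith

theorem IsLast.shift {K : Finset (ℤ × ℤ)} {u p : ℤ × ℤ} (h : IsLast K u p) (t : ℤ × ℤ) :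
    IsLast (shift t K) u (p + t) := by
  refine ⟨mem_supportSet_shift.2 (by simpa using h.1), fun y hy => ?_⟩
  have := h.2 _ (mem_supportSet_shift.1 hy)
  rw [det_sub_right] at this
  rw [det_add_right]
  linarith

/-! ### Neighbouring edges -/

/-- `v` is the first edge normal of `K` that follows the direction `u`. -/
def IsNext (K : Finset (ℤ × ℤ)) (u v : ℤ × ℤ) : Prop :=
  v ∈ edgeNormals K ∧ 0 < det u v ∧ ∀ w ∈ edgeNormals K, 0 < det u w → 0 ≤ det v w

/-- `v` is the last edge normal of `K` that precedes the direction `u`. -/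
def IsPrev (K : Finset (ℤ × ℤ)) (u v : ℤ × ℤ) : Prop :=
  v ∈ edgeNormals K ∧ 0 < det v u ∧ ∀ w ∈ edgeNormals K, 0 < det w u → 0 ≤ det w v

theorem IsPrev.mirror {K : Finset (ℤ × ℤ)} {u v : ℤ × ℤ} (h : IsPrev K u v) :
    IsNext (mirror K) (mir u) (mir v) := by
  refine ⟨mem_edgeNormals_mirror.2 h.1, ?_, fun w hw hw' => ?_⟩
  · rw [det_mir, ← det_swap]; exact h.2.1
  · rw [mem_edgeNormals_mirror] at hw
    have := h.2.2 _ hw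
    rw [← mir_mir w, det_mir, ← det_swap] at hw' ⊢
    exact this hw'

theorem IsNext.mirror {K : Finset (ℤ × ℤ)} {u v : ℤ × ℤ} (h : IsNext K u v) :
    IsPrev (mirror K) (mir u) (mir v) := by
  refine ⟨mem_edgeNormals_mirror.2 h.1, ?_, fun w hw hw' => ?_⟩
  · rw [det_mir, ← det_swap]; exact h.2.1
  · rw [mem_edgeNormals_mirror] at hw
    have := h.2.2 _ hw
    rw [← mir_mir w, det_mir, ← det_swap] at hw' ⊢
    exact this hw'

theorem mirror_mirror (K : Finset (ℤ × ℤ)) : mirror (mirror K) = K := by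
  ext x
  rw [mem_mirror, mem_mirror, mir_mir]

/-- Two points of an edge differ by a nonzero integer multiple of `rot u`, so the coordinates of `u`
are bounded by those of a difference of points of `K`. -/
theorem edgeNormals_finite (K : Finset (ℤ × ℤ)) : (edgeNormals K).Finite := by
  have hfin := ((((K ×ˢ K).image (fun x => x.1 - x.2)).image
      (fun d : ℤ × ℤ => Finset.Icc (-|d.2|, -|d.1|) (|d.2|, |d.1|))).sup id).finite_toSet
  refine hfin.subset fun u hu => ?_
  obtain ⟨hu0, hprim, hcard⟩ := hu
  obtain ⟨p, hp, q, hq, hne⟩ := Finset.one_lt_card.1 hcard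
  obtain ⟨k, hk⟩ := exists_smul_rot (d := p - q) hprim
    (by rw [dot_sub_left, dot_eq_of_mem_supportSet hp hq, sub_self])
  have hk0 : 1 ≤ |k| := by
    refine Int.one_le_abs fun h0 => hne ?_
    rw [h0, zero_smul] at hk
    exact sub_eq_zero.1 hk
  simp only [Finset.mem_coe, Finset.mem_sup, id]
  refine ⟨_, Finset.mem_image_of_mem _ (Finset.mem_image_of_mem _
    (Finset.mk_mem_product (mem_supportSet.1 hp).1 (mem_supportSet.1 hq).1)), ?_⟩
  simp only [hk, rot, Finset.mem_Icc, Prod.le_def, Prod.smul_fst, Prod.smul_snd, smul_eq_mul,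
    abs_mul, abs_neg]
  have h1 : |u.1| ≤ |k| * |u.1| := le_mul_of_one_le_left (abs_nonneg _) hk0
  have h2 : |u.2| ≤ |k| * |u.2| := le_mul_of_one_le_left (abs_nonneg _) hk0
  have h3 := abs_le.1 h1
  have h4 := abs_le.1 h2
  exact ⟨⟨h3.1, h4.1⟩, ⟨h3.2, h4.2⟩⟩

/-- Otherwise a sweep from `u` through the following half-turn meets no edge, so the last point of
the face `u` stays maximal in directions arbitrarily close to `-u`, and `K` has width zero in
direction `u`. -/
theorem exists_edgeNormal_det_pos {K : Finset (ℤ × ℤ)} (hK : IsLatticePolygon K) {u : ℤ × ℤ}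
    (hu : u ≠ 0) : ∃ w ∈ edgeNormals K, 0 < det u w := by
  by_contra hcon
  push Not at hcon
  obtain ⟨p, hp⟩ := exists_isLast hK.nonempty u
  have hall : ∀ y ∈ K, dot y u = dot p u := fun y hy => by
    refine le_antisymm (hp.dot_le hy) ?_
    by_contra hlt
    push Not at hlt
    -- A direction so close to `-u` that one unit of height lost along `u` outweighs the component
    -- of `y - p` along `rot u`.
    have hv : 0 < det u ((-(|dot (y - p) (rot u)| + 1)) • u + rot u) := by
      rw [det_add_right, det_smul_right, det_self, mul_zero, zero_add, det_rot_right]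
      exact dot_self_pos hu
    have h := (hp.isFirst_of_no_edge hv fun w hw h1 => absurd h1 (hcon w hw).not_gt).dot_le hy
    have h2 : dot (y - p) ((-(|dot (y - p) (rot u)| + 1)) • u + rot u) ≤ 0 := by
      rw [dot_sub_left]; linarith
    rw [dot_add_right, dot_smul_right] at h2
    have h3 : dot (y - p) u ≤ -1 := by rw [dot_sub_left]; omega
    have h4 := neg_abs_le (dot (y - p) (rot u))
    nlinarith [abs_nonneg (dot (y - p) (rot u))]
  obtain ⟨x, hx, y, hy, hlt⟩ := hK.exists_dot_lt u hu
  rw [hall x hx, hall y hy] at hlt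
  exact lt_irrefl _ hlt

theorem exists_isNext {K : Finset (ℤ × ℤ)} (hK : IsLatticePolygon K) {u : ℤ × ℤ} (hu : u ≠ 0) :
    ∃ v, IsNext K u v := by
  obtain ⟨w₀, hw₀, hpos₀⟩ := exists_edgeNormal_det_pos hK hu
  -- The ratio is the cotangent of the angle from `u` to `w`; the largest cotangent belongs to the
  -- smallest angle.
  obtain ⟨v, hv, hmax⟩ := ((edgeNormals_finite K).toFinset.filter
    (fun w => 0 < det u w)).exists_max_image (fun w => ((dot u w : ℤ) : ℚ) / (det u w : ℤ))
    ⟨w₀, by simp [hw₀, hpos₀]⟩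
  simp only [Finset.mem_filter, Set.Finite.mem_toFinset] at hv hmax
  refine ⟨v, hv.1, hv.2, fun w hw hpos => ?_⟩
  have := hmax w ⟨hw, hpos⟩
  rw [div_le_div_iff₀ (by exact_mod_cast hpos) (by exact_mod_cast hv.2)] at this
  have h1 : dot u w * det u v ≤ dot u v * det u w := by exact_mod_cast this
  have h2 : det v w * dot u u = dot u v * det u w - dot u w * det u v := by
    simp only [dot, det]; ring
  have h3 := dot_self_pos hu
  by_contra hneg
  nlinarith

theorem mir_ne_zero {u : ℤ × ℤ} (hu : u ≠ 0) : mir u ≠ 0 :=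
  fun h => hu (mir_injective (by rw [h]; rfl))

theorem exists_isPrev {K : Finset (ℤ × ℤ)} (hK : IsLatticePolygon K) {u : ℤ × ℤ} (hu : u ≠ 0) :
    ∃ v, IsPrev K u v := by
  obtain ⟨v, hv⟩ := exists_isNext hK.mirror (mir_ne_zero hu)
  have := hv.mirror
  rw [mirror_mirror, mir_mir] at this
  exact ⟨_, this⟩

section neighbours

variable {K : Finset (ℤ × ℤ)} {u v p : ℤ × ℤ}

theorem IsNext.isFirst (h : IsNext K u v) (hp : IsLast K u p) : IsFirst K v p :=
  hp.isFirst_of_no_edge h.2.1 fun w hw h1 h2 => by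
    have := h.2.2 w hw h1
    rw [det_swap] at this
    linarith

theorem IsPrev.isLast (h : IsPrev K u v) (hp : IsFirst K u p) : IsLast K v p := by
  have := (h.mirror.isFirst hp.mirror).mirror
  rwa [mirror_mirror] at this

theorem IsNext.neg (h : IsNext K u v) : IsNext (-K) (-u) (-v) := by
  refine ⟨mem_edgeNormals_neg.2 (by simpa using h.1), ?_, fun w hw hw' => ?_⟩
  · rw [det_neg_left, det_neg_right, neg_neg]; exact h.2.1
  · have := h.2.2 _ (mem_edgeNormals_neg.1 hw)
    rw [det_neg_right, det_neg_right] at this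
    rw [det_neg_left] at hw' ⊢
    exact this hw'

end neighbours

/-- A lattice polygon is the intersection of the half-planes of its edges. -/
theorem IsLatticePolygon.mem_of_forall_edge {K : Finset (ℤ × ℤ)} (hK : IsLatticePolygon K)
    {z : ℤ × ℤ} (h : ∀ w ∈ edgeNormals K, ∃ y ∈ K, dot z w ≤ dot y w) : z ∈ K := by
  have hmax : ∀ w ∈ edgeNormals K, ∀ p ∈ supportSet K w, dot z w ≤ dot p w := fun w hw p hp => by
    obtain ⟨y, hy, hle⟩ := h w hw
    exact hle.trans ((mem_supportSet.1 hp).2 y hy)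
  refine hK.mem_of_forall _ fun u => ?_
  rcases eq_or_ne u 0 with rfl | hu
  · obtain ⟨p, hp⟩ := hK.nonempty
    exact ⟨p, hp, by simp [dot]⟩
  obtain ⟨k, u', hk, rfl, hprim⟩ := exists_primitive hu
  have hu' := ne_zero_of_gcd hprim
  obtain ⟨p, hp⟩ := exists_isFirst hK.nonempty u'
  obtain ⟨q, hq⟩ := exists_isLast hK.nonempty u'
  refine ⟨p, hp.mem, ?_⟩
  rw [dot_smul_right, dot_smul_right]
  refine mul_le_mul_of_nonneg_left ?_ hk.le
  rcases eq_or_ne p q with rfl | hpq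
  · obtain ⟨v, hv⟩ := exists_isNext hK hu'
    obtain ⟨w, hw⟩ := exists_isPrev hK hu'
    have hpv := hv.isFirst hq
    have hpw := hw.isLast hp
    -- The face `u'` is the single vertex `p`, shared by the neighbouring edges `w` and `v`. If they
    -- span an angle less than a half-turn, `u'` lies in their cone. Otherwise `-w` lies in the cone
    -- of `u'` and `v`, so `p` maximizes both `w` and `-w`, against positive width.
    rcases lt_or_ge 0 (det w v) with hwv | hwv
    · exact dot_le_of_arc hwv hw.2.1.le hv.2.1.le (hmax w hw.1 p hpw.1) (hmax v hv.1 p hpv.1)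
    · exfalso
      have hall : ∀ y ∈ K, dot y w = dot p w := fun y hy => by
        have := dot_le_of_arc (w := -w) hv.2.1 (by rw [det_neg_right, ← det_swap]; exact hw.2.1.le)
          (by rw [det_neg_left]; linarith) (hp.dot_le hy) (hpv.dot_le hy)
        rw [dot_neg_right, dot_neg_right] at this
        exact le_antisymm (hpw.dot_le hy) (by linarith)
      obtain ⟨x, hx, y, hy, hlt⟩ := hK.exists_dot_lt w hw.1.1
      rw [hall x hx, hall y hy] at hlt
      exact lt_irrefl _ hlt
  · exact hmax u' (mem_edgeNormals_of_ne hprim hp.1 hq.1 hpq) p hp.1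

/-! ### Chains of edges -/

/-- The boundary chain between two faces is the sum of the edge vectors in between. -/
theorem first_sub_last_eq_sum {K : Finset (ℤ × ℤ)} (hK : IsLatticePolygon K)
    {V : Finset (ℤ × ℤ)} (hV : ∀ w ∈ V, Int.gcd w.1 w.2 = 1) (hKV : ∀ w ∈ edgeNormals K, w ∈ V) :
    ∀ (n : ℕ) {u v p q : ℤ × ℤ}, (V.filter fun w => 0 < det u w ∧ 0 < det w v).card = n →
      0 < det u v → IsLast K u p → IsFirst K v q →
      q - p = ∑ w ∈ V.filter (fun w => 0 < det u w ∧ 0 < det w v), len K w • rot w := by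
  intro n
  induction n using Nat.strong_induction_on with
  | _ n ih =>
    intro u v p q hn huv hp hq
    rcases (V.filter fun w => 0 < det u w ∧ 0 < det w v).eq_empty_or_nonempty with h0 | ⟨w, hw⟩
    · rw [h0, Finset.sum_empty, sub_eq_zero]
      have hv : v ≠ 0 := by
        rintro rfl
        simp [det] at huv
      refine hq.unique hv (hp.isFirst_of_no_edge huv fun w hw h1 h2 => ?_)
      have : w ∈ V.filter fun w => 0 < det u w ∧ 0 < det w v :=
        Finset.mem_filter.2 ⟨hKV w hw, h1, h2⟩
      rw [h0] at this
      simp at this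
    · obtain ⟨hwV, huw, hwv⟩ := Finset.mem_filter.1 hw
      obtain ⟨a, ha⟩ := exists_isFirst hK.nonempty w
      obtain ⟨b, hb⟩ := exists_isLast hK.nonempty w
      have hsplit : V.filter (fun x => 0 < det u x ∧ 0 < det x v) =
          insert w (V.filter (fun x => 0 < det u x ∧ 0 < det x w) ∪
            V.filter (fun x => 0 < det w x ∧ 0 < det x v)) := by
        ext x
        simp only [Finset.mem_filter, Finset.mem_insert, Finset.mem_union]
        constructor
        · rintro ⟨hx, h1, h2⟩
          rcases lt_trichotomy 0 (det w x) with h | h | h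
          · exact Or.inr (Or.inr ⟨hx, h, h2⟩)
          · rcases eq_or_eq_neg_of_det_eq_zero (hV w hwV) (hV x hx) h.symm with e | e
            · exact Or.inl e
            · rw [e, det_neg_right] at h1
              omega
          · exact Or.inr (Or.inl ⟨hx, h1, by rw [det_swap]; omega⟩)
        · rintro (rfl | ⟨hx, h1, h2⟩ | ⟨hx, h1, h2⟩)
          · exact ⟨hwV, huw, hwv⟩
          · refine ⟨hx, h1, ?_⟩
            have := det_mul_det x u w v
            have h3 : det x u = - det u x := det_swap _ _
            have h4 : 0 < det x v * det u w := by
              rw [this, h3, det_swap w v]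
              have h5 := mul_pos h1 hwv
              have h6 := mul_pos h2 huv
              linarith
            exact pos_of_mul_pos_left h4 huw.le
          · refine ⟨hx, ?_, h2⟩
            exact det_pos_of_between hwv h1 h2.le huw huv
      have hw1 : w ∉ V.filter (fun x => 0 < det u x ∧ 0 < det x w) ∪
            V.filter (fun x => 0 < det w x ∧ 0 < det x v) := by
        simp [det_self]
      have hdisj : Disjoint (V.filter (fun x => 0 < det u x ∧ 0 < det x w))
            (V.filter (fun x => 0 < det w x ∧ 0 < det x v)) := by
        refine Finset.disjoint_left.2 fun x hx hx' => ?_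
        have h1 := (Finset.mem_filter.1 hx).2.2
        have h2 := (Finset.mem_filter.1 hx').2.1
        rw [det_swap] at h1
        omega
      have hcard := congrArg Finset.card hsplit
      rw [Finset.card_insert_of_notMem hw1, Finset.card_union_of_disjoint hdisj, hn] at hcard
      have e1 := ih _ (by omega) rfl huw hp ha
      have e2 := ih _ (by omega) rfl hwv hb hq
      rw [hsplit, Finset.sum_insert hw1, Finset.sum_union hdisj, ← e1, ← e2,
        last_eq_first_add hK (hV w hwV) ha hb]
      abel

/-! ### The covariogram -/

theorem covariogram_apply (K : Finset (ℤ × ℤ)) (x : ℤ × ℤ) :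
    covariogram K x = (K.filter fun z => z - x ∈ K).card := by
  rw [covariogram]
  congr 1
  ext z
  rw [Finset.mem_inter, Finset.mem_filter]
  exact and_congr_right fun _ => mem_shift

theorem covariogram_neg (K : Finset (ℤ × ℤ)) : covariogram (-K) = covariogram K := by
  funext x
  rw [covariogram_apply, covariogram_apply]
  refine Finset.card_nbij' (fun z => x - z) (fun z => x - z) ?_ ?_ ?_ ?_
  · intro z hz
    simp only [Finset.mem_neg', Finset.coe_filter, Set.mem_ofPred_eq] at hz ⊢
    exact ⟨by simpa using hz.2, by simpa using hz.1⟩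
  · intro z hz
    simp only [Finset.mem_neg', Finset.coe_filter, Set.mem_ofPred_eq] at hz ⊢
    exact ⟨by simpa using hz.2, by simpa using hz.1⟩
  · intro z _; simp
  · intro z _; simp

theorem covariogram_shift (K : Finset (ℤ × ℤ)) (t : ℤ × ℤ) :
    covariogram (shift t K) = covariogram K := by
  funext x
  rw [covariogram_apply, covariogram_apply]
  refine Finset.card_nbij' (fun z => z - t) (fun z => z + t) ?_ ?_ ?_ ?_
  · intro z hz
    simp only [mem_shift, Finset.coe_filter, Set.mem_ofPred_eq] at hz ⊢
    exact ⟨hz.1, by rw [sub_right_comm]; exact hz.2⟩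
  · intro z hz
    simp only [mem_shift, Finset.coe_filter, Set.mem_ofPred_eq] at hz ⊢
    exact ⟨by simpa using hz.1, by rw [add_sub_right_comm, add_sub_cancel_right]; exact hz.2⟩
  · intro z _; simp
  · intro z _; simp

theorem mir_sub (x y : ℤ × ℤ) : mir (x - y) = mir x - mir y := rfl

theorem covariogram_mirror (K : Finset (ℤ × ℤ)) (x : ℤ × ℤ) :
    covariogram (mirror K) x = covariogram K (mir x) := by
  rw [covariogram_apply, covariogram_apply]
  refine Finset.card_nbij' mir mir ?_ ?_ ?_ ?_
  · intro z hz
    simp only [mem_mirror, Finset.coe_filter, Set.mem_ofPred_eq, mir_sub] at hz ⊢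
    exact hz
  · intro z hz
    simp only [mem_mirror, Finset.coe_filter, Set.mem_ofPred_eq, mir_sub, mir_mir] at hz ⊢
    exact hz
  · intro z _; rfl
  · intro z _; rfl

/-- A difference `x` is attained by exactly `covariogram K x` pairs. The set `D` only makes the sum
finite; taking it large enough for both sets allows two polygons to be compared term by term. -/
theorem card_pairs (K : Finset (ℤ × ℤ)) (Q : ℤ × ℤ → Prop) [DecidablePred Q]
    {D : Finset (ℤ × ℤ)} (hD : ∀ y ∈ K, ∀ z ∈ K, y - z ∈ D) :
    ((K ×ˢ K).filter fun y => Q (y.1 - y.2)).card = ∑ x ∈ D.filter Q, covariogram K x := by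
  rw [Finset.card_eq_sum_card_fiberwise (f := fun y => y.1 - y.2) (t := D.filter Q)]
  · refine Finset.sum_congr rfl fun x hx => ?_
    rw [covariogram_apply]
    refine Finset.card_nbij' (fun y => y.1) (fun z => (z, z - x)) ?_ ?_ ?_ ?_
    · intro y hy
      simp only [Finset.coe_filter, Finset.mem_filter, Finset.mem_product, Set.mem_ofPred_eq] at hy ⊢
      refine ⟨hy.1.1.1, ?_⟩
      rw [← hy.2, sub_sub_cancel]
      exact hy.1.1.2
    · intro z hz
      simp only [Finset.coe_filter, Finset.mem_filter, Finset.mem_product, Set.mem_ofPred_eq] at hz ⊢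
      rw [sub_sub_cancel]
      exact ⟨⟨hz, (Finset.mem_filter.1 hx).2⟩, rfl⟩
    · intro y hy
      simp only [Finset.coe_filter, Finset.mem_filter, Finset.mem_product, Set.mem_ofPred_eq] at hy
      exact Prod.ext rfl (by simp only [← hy.2, sub_sub_cancel])
    · intro z _; rfl
  · intro y hy
    simp only [Finset.coe_filter, Finset.mem_product, Set.mem_ofPred_eq] at hy ⊢
    exact ⟨hD _ hy.1.1 _ hy.1.2, hy.2⟩

/-! ### Opposite faces of sets with equal covariograms -/

section comparison

variable {K L : Finset (ℤ × ℤ)}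

theorem card_pairs_eq (hg : covariogram K = covariogram L) (Q : ℤ × ℤ → Prop) [DecidablePred Q] :
    ((K ×ˢ K).filter fun y => Q (y.1 - y.2)).card =
      ((L ×ˢ L).filter fun y => Q (y.1 - y.2)).card := by
  have h1 : ∀ y ∈ K, ∀ z ∈ K, y - z ∈ (K - K) ∪ (L - L) := fun y hy z hz =>
    Finset.mem_union_left _ (Finset.sub_mem_sub hy hz)
  have h2 : ∀ y ∈ L, ∀ z ∈ L, y - z ∈ (K - K) ∪ (L - L) := fun y hy z hz =>
    Finset.mem_union_right _ (Finset.sub_mem_sub hy hz)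
  rw [card_pairs K Q h1, card_pairs L Q h2, hg]

theorem exists_sub_eq (hg : covariogram K = covariogram L) {y z : ℤ × ℤ} (hy : y ∈ K)
    (hz : z ∈ K) : ∃ y' ∈ L, ∃ z' ∈ L, y' - z' = y - z := by
  have h : 0 < covariogram K (y - z) := by
    rw [covariogram_apply]
    exact Finset.card_pos.2 ⟨y, by simp [hy, hz]⟩
  rw [hg, covariogram_apply] at h
  obtain ⟨w, hw⟩ := Finset.card_pos.1 h
  rw [Finset.mem_filter] at hw
  exact ⟨w, hw.1, _, hw.2, by abel⟩

theorem dot_last_sub_le {u p p' y z : ℤ × ℤ} (hp : IsLast K u p) (hp' : IsLast K (-u) p')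
    (hy : y ∈ K) (hz : z ∈ K) : dot (y - z) u ≤ dot (p - p') u := by
  have h1 := hp.dot_le hy
  have h2 := hp'.dot_le hz
  rw [dot_neg_right, dot_neg_right] at h2
  rw [dot_sub_left, dot_sub_left]
  linarith

theorem det_last_sub_le {u p p' y z : ℤ × ℤ} (hp : IsLast K u p) (hp' : IsLast K (-u) p')
    (hy : y ∈ K) (hz : z ∈ K) (h : dot (y - z) u = dot (p - p') u) :
    det u (y - z) ≤ det u (p - p') := by
  have h1 := hp.dot_le hy
  have h2 := hp'.dot_le hz
  rw [dot_sub_left, dot_sub_left] at h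
  rw [dot_neg_right, dot_neg_right] at h2
  have h3 := hp.2 y (mem_supportSet_of_dot_eq hp.1 hy (by linarith))
  have h4 := hp'.2 z (mem_supportSet_of_dot_eq hp'.1 hz (by
    rw [dot_neg_right, dot_neg_right]; linarith))
  rw [det_neg_left, det_neg_left] at h4
  rw [det_sub_right, det_sub_right]
  linarith

/-- The difference of opposite vertices is determined by the covariogram. -/
theorem last_sub_last_eq (hg : covariogram K = covariogram L) {u p p' q q' : ℤ × ℤ} (hu : u ≠ 0)
    (hp : IsLast K u p) (hp' : IsLast K (-u) p') (hq : IsLast L u q) (hq' : IsLast L (-u) q') :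
    p - p' = q - q' := by
  -- The difference sets of `K` and `L` coincide, and `p - p'` is the element of `K - K` that
  -- maximizes first `dot · u` and then `det u`.
  obtain ⟨y, hy, z, hz, h1⟩ := exists_sub_eq hg hp.mem hp'.mem
  obtain ⟨y', hy', z', hz', h2⟩ := exists_sub_eq hg.symm hq.mem hq'.mem
  have h3 := dot_last_sub_le hq hq' hy hz
  have h4 := dot_last_sub_le hp hp' hy' hz'
  rw [h1] at h3
  rw [h2] at h4
  have h5 := le_antisymm h3 h4
  have h6 := det_last_sub_le hq hq' hy hz (by rw [h1, h5])
  have h7 := det_last_sub_le hp hp' hy' hz' (by rw [h2, h5])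
  rw [h1] at h6
  rw [h2] at h7
  exact eq_of_dot_eq_of_det_eq hu h5 (le_antisymm h6 h7)

theorem first_sub_first_eq (hg : covariogram K = covariogram L) {u p p' q q' : ℤ × ℤ} (hu : u ≠ 0)
    (hp : IsFirst K u p) (hp' : IsFirst K (-u) p') (hq : IsFirst L u q)
    (hq' : IsFirst L (-u) q') : p - p' = q - q' := by
  have hg' : covariogram (mirror K) = covariogram (mirror L) := by
    funext x
    rw [covariogram_mirror, covariogram_mirror, hg]
  have := last_sub_last_eq hg' (mir_ne_zero hu) hp.mirror hp'.mirror hq.mirror hq'.mirror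
  rw [← mir_sub, ← mir_sub] at this
  exact mir_injective this

/-- A difference is maximal in direction `u` exactly when its first point lies on the face `u` and
its second on the face `-u`. -/
theorem card_supportSet_mul {u p p' : ℤ × ℤ} (hp : IsLast K u p)
    (hp' : IsLast K (-u) p') :
    ((K ×ˢ K).filter fun y => dot (y.1 - y.2) u = dot (p - p') u).card =
      (supportSet K u).card * (supportSet K (-u)).card := by
  rw [← Finset.card_product]
  congr 1
  ext ⟨y, z⟩
  simp only [Finset.mem_filter, Finset.mem_product]
  constructor
  · rintro ⟨⟨hy, hz⟩, h⟩
    have h1 := hp.dot_le hy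
    have h2 := hp'.dot_le hz
    rw [dot_sub_left, dot_sub_left] at h
    rw [dot_neg_right, dot_neg_right] at h2
    exact ⟨mem_supportSet_of_dot_eq hp.1 hy (by linarith),
      mem_supportSet_of_dot_eq hp'.1 hz (by rw [dot_neg_right, dot_neg_right]; linarith)⟩
  · rintro ⟨hy, hz⟩
    refine ⟨⟨(mem_supportSet.1 hy).1, (mem_supportSet.1 hz).1⟩, ?_⟩
    have h1 := dot_eq_of_mem_supportSet hy hp.1
    have h2 := dot_eq_of_mem_supportSet hz hp'.1
    rw [dot_neg_right, dot_neg_right] at h2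
    rw [dot_sub_left, dot_sub_left]
    linarith

/-- The lengths of opposite edges are determined by the covariogram, up to their order. -/
theorem len_eq_or_eq (hK : IsLatticePolygon K) (hL : IsLatticePolygon L)
    (hg : covariogram K = covariogram L) {u : ℤ × ℤ} (hu : Int.gcd u.1 u.2 = 1) :
    (len K u = len L u ∧ len K (-u) = len L (-u)) ∨
      (len K u = len L (-u) ∧ len K (-u) = len L u) := by
  have hu0 := ne_zero_of_gcd hu
  obtain ⟨a, ha⟩ := exists_isFirst hK.nonempty u
  obtain ⟨a', ha'⟩ := exists_isFirst hK.nonempty (-u)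
  obtain ⟨p, hp⟩ := exists_isLast hK.nonempty u
  obtain ⟨p', hp'⟩ := exists_isLast hK.nonempty (-u)
  obtain ⟨b, hb⟩ := exists_isFirst hL.nonempty u
  obtain ⟨b', hb'⟩ := exists_isFirst hL.nonempty (-u)
  obtain ⟨q, hq⟩ := exists_isLast hL.nonempty u
  obtain ⟨q', hq'⟩ := exists_isLast hL.nonempty (-u)
  -- The two vertex differences bound the edge of `K - K` with normal `u`, whose length is the sum
  -- of the lengths of the opposite faces of `K`.
  have hlast := last_sub_last_eq hg hu0 hp hp' hq hq'
  have hfirst := first_sub_first_eq hg hu0 ha ha' hb hb'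
  have hsum : len K u + len K (-u) = len L u + len L (-u) := by
    refine smul_rot_injective hu0 ?_
    have e1 := last_eq_first_add hK hu ha hp
    have e2 := last_eq_first_add hK (gcd_neg hu) ha' hp'
    have e3 := last_eq_first_add hL hu hb hq
    have e4 := last_eq_first_add hL (gcd_neg hu) hb' hq'
    rw [rot_neg, smul_neg] at e2 e4
    have f1 : (len K u + len K (-u)) • rot u = (p - p') - (a - a') := by
      rw [e1, e2, add_smul]; abel
    have f2 : (len L u + len L (-u)) • rot u = (q - q') - (b - b') := by
      rw [e3, e4, add_smul]; abel
    rw [f1, f2, hlast, hfirst]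
  have hprod := card_pairs_eq hg (fun x => dot x u = dot (p - p') u)
  rw [card_supportSet_mul hp hp', hlast, card_supportSet_mul hq hq'] at hprod
  have h1 : (len K u + 1) * (len K (-u) + 1) = (len L u + 1) * (len L (-u) + 1) := by
    simp only [len, sub_add_cancel]
    exact_mod_cast hprod
  -- Equal sum and equal product: both pairs of lengths are the roots of the same quadratic
  -- polynomial.
  have h2 : (len K u - len L u) * (len K u - len L (-u)) = 0 := by
    have : len K (-u) = len L u + len L (-u) - len K u := by linarith
    rw [this] at h1
    linear_combination -h1
  rcases mul_eq_zero.1 h2 with h | h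
  · left; constructor <;> linarith
  · right; constructor <;> linarith

end comparison

/-! ### Caps opposite to a long edge -/

theorem covariogram_apply_add (K : Finset (ℤ × ℤ)) (x : ℤ × ℤ) :
    covariogram K x = (K.filter fun z => z + x ∈ K).card := by
  rw [covariogram_apply]
  refine Finset.card_nbij' (fun z => z - x) (fun z => z + x) ?_ ?_ ?_ ?_
  · intro z hz
    simp only [Finset.coe_filter, Set.mem_ofPred_eq] at hz ⊢
    exact ⟨hz.2, by simpa using hz.1⟩
  · intro z hz
    simp only [Finset.coe_filter, Set.mem_ofPred_eq] at hz ⊢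
    exact ⟨hz.2, by simpa using hz.1⟩
  · intro z _; simp
  · intro z _; simp

/-- The points of `K` whose height above `w` in the direction `u` is at most `r`. -/
def cap (K : Finset (ℤ × ℤ)) (u w : ℤ × ℤ) (r : ℤ) : Finset (ℤ × ℤ) :=
  K.filter fun z => dot (z - w) u ≤ r

section caps

variable {K : Finset (ℤ × ℤ)} {u m₀ m₁ p p₂ w₁ w₂ x y z : ℤ × ℤ}

/-- The points `w₁` and `w₂` are maximal on `K` for `m₀` and `m₁`, so `h₀` and `h₁` put all of `K +
x` behind the lines through `p` and `p₂` with these normals. Every edge normal other than `±u` lies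
weakly between `u` and `m₀` or between `m₁` and `u`, where `p` or `p₂` then dominates. Only the
inequality for `u` remains. -/
theorem add_mem_iff_of_fit (hK : IsLatticePolygon K) (hu : Int.gcd u.1 u.2 = 1)
    (hm₀ : IsPrev K (-u) m₀) (hm₁ : IsNext K (-u) m₁) (hp : IsLast K u p) (hp₂ : IsFirst K u p₂)
    (hw₁ : IsFirst K (-u) w₁) (hw₂ : IsLast K (-u) w₂) (h₀ : dot (w₁ + x - p) m₀ ≤ 0)
    (h₁ : dot (w₂ + x - p₂) m₁ ≤ 0) (hx : 0 ≤ dot x u) (hz : z ∈ K) :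
    z + x ∈ K ↔ dot (z + x) u ≤ dot p u := by
  refine ⟨fun h => hp.dot_le h, fun h => hK.mem_of_forall_edge fun w hw => ?_⟩
  have hpp : dot p u = dot p₂ u := dot_eq_of_mem_supportSet hp.1 hp₂.1
  have hum₀ : 0 < det u m₀ := by
    have := hm₀.2.1
    rwa [det_neg_right, ← det_swap] at this
  have hm₁u : 0 < det m₁ u := by
    have := hm₁.2.1
    rwa [det_neg_left, ← det_swap] at this
  rw [dot_sub_left, dot_add_left] at h₀ h₁
  rcases lt_trichotomy (det u w) 0 with hd | hd | hd
  · refine ⟨p₂, hp₂.mem, dot_le_of_arc hm₁u ?_ ?_ ?_ (hpp ▸ h)⟩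
    · exact hm₁.2.2 w hw (by rw [det_neg_left]; linarith)
    · rw [det_swap]; linarith
    · have := (hm₁.isFirst hw₂).dot_le hz
      rw [dot_add_left]
      linarith
  · rcases eq_or_eq_neg_of_det_eq_zero hu hw.2.1 hd with rfl | rfl
    · exact ⟨p, hp.mem, h⟩
    · refine ⟨z, hz, ?_⟩
      rw [dot_neg_right, dot_neg_right, dot_add_left]
      linarith
  · refine ⟨p, hp.mem, dot_le_of_arc hum₀ hd.le ?_ h ?_⟩
    · exact hm₀.2.2 w hw (by rw [det_neg_right, ← det_swap]; exact hd)
    · have := (hm₀.isLast hw₁).dot_le hz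
      rw [dot_add_left]
      linarith

theorem dot_add_le_iff (p w y z u : ℤ × ℤ) :
    dot (z + (p - w + y)) u ≤ dot p u ↔ dot (z - w) u ≤ -dot y u := by
  simp only [dot_add_left, dot_sub_left]
  constructor <;> intro h <;> linarith

/-- The translation moves `w₂` to `p + y`. Conditions `h₀` and `h₁` say that the translated short
edge `-u` stays behind the lines of `m₀` at the last point and of `m₁` at the first point of the
edge `u`, so the line of `u` alone cuts the translate. Without them the cap is still an upper bound.
-/
theorem covariogram_eq_card_cap (hK : IsLatticePolygon K) (hu : Int.gcd u.1 u.2 = 1)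
    (hm₀ : IsPrev K (-u) m₀) (hm₁ : IsNext K (-u) m₁) (hp : IsLast K u p)
    (hw₂ : IsLast K (-u) w₂) (h₀ : dot (y + len K (-u) • rot u) m₀ ≤ 0)
    (h₁ : dot (y + len K u • rot u) m₁ ≤ 0) (hx : 0 ≤ dot (p - w₂ + y) u) :
    covariogram K (p - w₂ + y) = (cap K u w₂ (-dot y u)).card := by
  obtain ⟨p₂, hp₂⟩ := exists_isFirst hK.nonempty u
  obtain ⟨w₁, hw₁⟩ := exists_isFirst hK.nonempty (-u)
  rw [covariogram_apply_add, cap]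
  congr 1
  refine Finset.filter_congr fun z hz => ?_
  rw [← dot_add_le_iff p w₂ y z u]
  have e1 := last_eq_first_add hK (gcd_neg hu) hw₁ hw₂
  have e2 := last_eq_first_add hK hu hp₂ hp
  rw [rot_neg, smul_neg] at e1
  refine add_mem_iff_of_fit hK hu hm₀ hm₁ hp hp₂ hw₁ hw₂ ?_ ?_ hx hz
  · convert h₀ using 2
    rw [e1]; abel
  · convert h₁ using 2
    rw [e2]; abel

theorem filter_add_mem_subset_cap (hp : IsLast K u p) :
    (K.filter fun z => z + (p - w₂ + y) ∈ K) ⊆ cap K u w₂ (-dot y u) := fun z hz => by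
  rw [Finset.mem_filter] at hz
  exact Finset.mem_filter.2 ⟨hz.1, (dot_add_le_iff p w₂ y z u).1 (hp.dot_le hz.2)⟩

theorem covariogram_le_card_cap (hp : IsLast K u p) :
    covariogram K (p - w₂ + y) ≤ (cap K u w₂ (-dot y u)).card := by
  rw [covariogram_apply_add]
  exact Finset.card_le_card (filter_add_mem_subset_cap hp)

theorem covariogram_lt_card_cap (hp : IsLast K u p) (hz : z ∈ cap K u w₂ (-dot y u))
    (hzx : z + (p - w₂ + y) ∉ K) :
    covariogram K (p - w₂ + y) < (cap K u w₂ (-dot y u)).card := by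
  rw [covariogram_apply_add]
  refine Finset.card_lt_card ((Finset.ssubset_iff_of_subset (filter_add_mem_subset_cap hp)).2
    ⟨z, hz, fun h => hzx (Finset.mem_filter.1 h).2⟩)

theorem card_cap_eq (K : Finset (ℤ × ℤ)) (u w : ℤ × ℤ) (r : ℤ) :
    (cap K u w r).card =
      (cap K u w (r - 1)).card + (K.filter fun z => dot (z - w) u = r).card := by
  rw [← Finset.card_union_of_disjoint]
  · congr 1
    ext z
    simp only [cap, Finset.mem_union, Finset.mem_filter]
    constructor
    · rintro ⟨h1, h2⟩
      rcases h2.lt_or_eq with h | h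
      · exact Or.inl ⟨h1, by omega⟩
      · exact Or.inr ⟨h1, h⟩
    · rintro (⟨h1, h2⟩ | ⟨h1, h2⟩)
      · exact ⟨h1, by omega⟩
      · exact ⟨h1, h2.le⟩
  · refine Finset.disjoint_left.2 fun z h1 h2 => ?_
    have h3 := (Finset.mem_filter.1 h1).2
    have h4 := (Finset.mem_filter.1 h2).2
    omega

theorem IsLast.add_rot_notMem (hp : IsLast K u p) (hu : u ≠ 0) : p + rot u ∉ K := fun h => by
  have h1 := hp.2 _ (mem_supportSet_of_dot_eq hp.1 h (by
    rw [dot_add_left, dot_rot_left, det_self, add_zero]))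
  rw [det_add_right, det_rot_right] at h1
  linarith [dot_self_pos hu]

end caps

/-! ### Sets with long edges -/

/-- `V` is a symmetric set of primitive directions that contains the edge normals of `K`, its
nonzero determinants lie between `e` and `D`, and the edges of `K`, as well as the differences of
opposite edges, have lattice length at least `(D / e) ^ 2 + D / e`. -/
structure HasLongEdges (V : Finset (ℤ × ℤ)) (e D : ℤ) (K : Finset (ℤ × ℤ)) : Prop where
  pos : 0 < e
  gcd_eq_one : ∀ w ∈ V, Int.gcd w.1 w.2 = 1
  neg_mem : ∀ w ∈ V, -w ∈ V
  le_det : ∀ v ∈ V, ∀ w ∈ V, 0 < det v w → e ≤ det v w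
  det_le : ∀ v ∈ V, ∀ w ∈ V, det v w ≤ D
  mem : ∀ w ∈ edgeNormals K, w ∈ V
  le_len : ∀ w ∈ edgeNormals K, D * (D + e) ≤ len K w * e ^ 2
  le_len_sub : ∀ w ∈ edgeNormals K, len K (-w) < len K w →
    D * (D + e) ≤ (len K w - len K (-w)) * e ^ 2

/-- With `δ = D / e` the assumptions read `t ≤ δ + 1` and `M ≥ δ * (δ + 1)`, whence `t * D ≤ M * e`.
All size comparisons between determinants weighted by step numbers and by edge lengths reduce to
this. -/
theorem mul_le_mul_of_long {t d d' M e D : ℤ} (he : 0 < e) (ht : 0 < t) (hte : t * e ≤ D + e)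
    (hD : 0 < D) (hM : D * (D + e) ≤ M * e ^ 2) (hd : d ≤ D) (hd' : e ≤ d') : t * d ≤ M * d' := by
  have h1 : (t * D) * e ≤ (M * e) * e := by nlinarith
  have h2 : t * D ≤ M * e := le_of_mul_le_mul_right h1 he
  have h3 : 0 < M := by
    by_contra h
    nlinarith [mul_pos ht hD]
  calc t * d ≤ t * D := mul_le_mul_of_nonneg_left hd ht.le
    _ ≤ M * e := h2
    _ ≤ M * d' := mul_le_mul_of_nonneg_left hd' h3.le

/-- Points on a low row opposite to an edge belong to the polygon when they satisfy the inequality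
of the preceding edge. -/
theorem row_mem {L : Finset (ℤ × ℤ)} (hL : IsLatticePolygon L) {u m₀ m₁ w₁ w₂ : ℤ × ℤ}
    (hu : Int.gcd u.1 u.2 = 1)
    (hm₀ : IsPrev L (-u) m₀) (hm₁ : IsNext L (-u) m₁) (hw₁ : IsFirst L (-u) w₁)
    (hw₂ : IsLast L (-u) w₂) {i t : ℤ} (hi : 0 ≤ i) (ht : 0 ≤ t) (ht₁ : t ≤ len L m₁)
    (ht₀ : t * det m₁ u ≤ len L m₀ * det u m₀)
    (h : (i - len L (-u)) * det u m₀ + t * det m₁ m₀ ≤ 0) :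
    w₂ + (i • rot u + t • rot m₁) ∈ L := by
  have e1 := last_eq_first_add hL (gcd_neg hu) hw₁ hw₂
  rw [rot_neg, smul_neg] at e1
  have hum₀ : 0 < det u m₀ := by
    have := hm₀.2.1
    rwa [det_neg_right, ← det_swap] at this
  have hm₁u : 0 < det m₁ u := by
    have := hm₁.2.1
    rwa [det_neg_left, ← det_swap] at this
  have hA := (hm₁.isFirst hw₂).add_mem hL hm₁.1.2.1 ht ht₁
  have hE := (hm₀.isLast hw₁).sub_mem hL hm₀.1.2.1 (len_nonneg hL) le_rfl
  refine hL.mem_of_forall_edge fun w hw => ?_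
  -- On the side of `m₁` the point on the edge `m₁` dominates. On the side of `m₀` the far end of
  -- the edge `m₀` does, being at least as high as the row by `ht₀` and satisfying the inequality of
  -- `m₀` by `h`.
  rcases lt_trichotomy (det u w) 0 with hd | hd | hd
  · refine ⟨_, hA, ?_⟩
    simp only [dot_add_left, dot_smul_left, dot_rot_left]
    nlinarith
  · rcases eq_or_eq_neg_of_det_eq_zero hu hw.2.1 hd with rfl | rfl
    · refine ⟨_, hA, ?_⟩
      simp only [dot_add_left, dot_smul_left, dot_rot_left, det_self]
      linarith
    · refine ⟨_, hw₂.mem, ?_⟩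
      simp only [dot_add_left, dot_smul_left, dot_rot_left, det_self, det_neg_right]
      nlinarith
  · refine ⟨_, hE, dot_le_of_arc hum₀ hd.le ?_ ?_ ?_⟩
    · exact hm₀.2.2 w hw (by rw [det_neg_right, ← det_swap]; exact hd)
    · simp only [e1, dot_add_left, dot_sub_left, dot_neg_left, dot_smul_left, dot_rot_left,
        det_self]
      rw [det_swap u m₀]
      linarith
    · simp only [e1, dot_add_left, dot_sub_left, dot_neg_left, dot_smul_left, dot_rot_left,
        det_self]
      linarith

/-- An integer in an interval `[X / a, Y / b]` of length at least one. -/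
theorem exists_int_between {X Y a b : ℤ} (ha : 0 < a) (h : a * b ≤ Y * a - X * b) (hb : 0 < b) :
    ∃ i : ℤ, X ≤ i * a ∧ i * b ≤ Y := by
  -- This is `X / a` rounded up.
  refine ⟨-((-X) / a), ?_, ?_⟩
  · have := Int.ediv_mul_le (-X) ha.ne'
    linarith
  · have h1 := Int.lt_ediv_add_one_mul_self (-X) ha
    have h2 : (-((-X) / a)) * a < X + a := by linarith
    have h3 : (-((-X) / a) * b) * a ≤ Y * a := by nlinarith
    exact le_of_mul_le_mul_right h3 ha

theorem exists_dot_eq_one {u : ℤ × ℤ} (hu : Int.gcd u.1 u.2 = 1) : ∃ x, dot x u = 1 := by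
  obtain ⟨a, b, hab⟩ := Int.isCoprime_iff_gcd_eq_one.2 hu
  exact ⟨(a, b), hab⟩

theorem det_pos_of_isPrev_neg {K : Finset (ℤ × ℤ)} {u m₀ : ℤ × ℤ} (h : IsPrev K (-u) m₀) :
    0 < det u m₀ := by
  have := h.2.1
  rwa [det_neg_right, ← det_swap] at this

theorem det_pos_of_isNext_neg {K : Finset (ℤ × ℤ)} {u m₁ : ℤ × ℤ} (h : IsNext K (-u) m₁) :
    0 < det m₁ u := by
  have := h.2.1
  rwa [det_neg_left, ← det_swap] at this

set_option maxHeartbeats 1000000 in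
/-- Opposite to an edge that `K` and `L` have in common and that is longer than the opposite one,
the edges that follow in `K` and in `L` do not have different directions. -/
theorem not_det_pos_of_isNext {K L V : Finset (ℤ × ℤ)} {e D : ℤ} (hK : IsLatticePolygon K)
    (hL : IsLatticePolygon L) (hKV : HasLongEdges V e D K) (hLV : HasLongEdges V e D L)
    (hg : covariogram K = covariogram L) {u m₂ m₃ : ℤ × ℤ} (hu : Int.gcd u.1 u.2 = 1)
    (h₁ : len K u = len L u) (h₂ : len K (-u) = len L (-u)) (hlt : len K (-u) < len K u)
    (hm₃ : IsNext K (-u) m₃) (hm₂ : IsNext L (-u) m₂) : ¬ 0 < det m₂ m₃ := by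
  intro hd₂₃
  have hu0 := ne_zero_of_gcd hu
  have hnu0 := ne_zero_of_gcd (gcd_neg hu)
  have huK : u ∈ edgeNormals K :=
    mem_edgeNormals.2 ⟨hu, (len_nonneg hK).trans_lt hlt⟩
  obtain ⟨p, hp⟩ := exists_isLast hK.nonempty u
  obtain ⟨w, hw⟩ := exists_isLast hK.nonempty (-u)
  obtain ⟨a, ha⟩ := exists_isFirst hK.nonempty (-u)
  obtain ⟨q, hq⟩ := exists_isLast hL.nonempty u
  obtain ⟨x, hx⟩ := exists_isLast hL.nonempty (-u)
  obtain ⟨b, hb⟩ := exists_isFirst hL.nonempty (-u)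
  obtain ⟨m₀, hm₀⟩ := exists_isPrev hK hnu0
  obtain ⟨n₀, hn₀⟩ := exists_isPrev hL hnu0
  have hpq : p - w = q - x := last_sub_last_eq hg hu0 hp hw hq hx
  -- the determinants
  have uV := hKV.mem _ huK
  have m₀V := hKV.mem _ hm₀.1
  have m₃V := hKV.mem _ hm₃.1
  have m₂V := hLV.mem _ hm₂.1
  have n₀V := hLV.mem _ hn₀.1
  have he := hKV.pos
  have hd₀ := det_pos_of_isPrev_neg hm₀
  have hd₀' := det_pos_of_isPrev_neg hn₀
  have hd₂ := det_pos_of_isNext_neg hm₂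
  have hd₃ := det_pos_of_isNext_neg hm₃
  have hd₀e := hKV.le_det _ uV _ m₀V hd₀
  have hd₀e' := hKV.le_det _ uV _ n₀V hd₀'
  have hd₂₃e := hKV.le_det _ m₂V _ m₃V hd₂₃
  have hd₂D := hKV.det_le _ m₂V _ uV
  have hd₃D := hKV.det_le _ m₃V _ uV
  have hf₀D := hKV.det_le _ m₀V _ m₂V
  have hf₀D' := hKV.det_le _ n₀V _ m₂V
  rw [det_swap] at hf₀D hf₀D'
  have hum₂ : det u m₂ = -det m₂ u := det_swap _ _
  have hum₃ : det u m₃ = -det m₃ u := det_swap _ _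
  have hD : 0 < D := lt_of_lt_of_le (he.trans_le hd₂₃e) (hKV.det_le _ m₂V _ m₃V)
  have heD : e ≤ D := hd₂₃e.trans (hKV.det_le _ m₂V _ m₃V)
  -- the height of the caps
  obtain ⟨t, ht₁, ht₂⟩ : ∃ t : ℤ, det m₃ u < t * det m₂ m₃ ∧ (t - 1) * det m₂ m₃ ≤ det m₃ u :=
    ⟨det m₃ u / det m₂ m₃ + 1, Int.lt_ediv_add_one_mul_self _ hd₂₃, by
      rw [add_sub_cancel_right]; exact Int.ediv_mul_le _ hd₂₃.ne'⟩
  have ht : 0 < t := pos_of_mul_pos_left (hd₃.trans ht₁) hd₂₃.le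
  -- The number `t` is the least integer with `t * det m₂ m₃ > det m₃ u`; hence it is at most `D / e
  -- + 1`.
  have hte : t * e ≤ D + e := by nlinarith
  have hlong := hKV.le_len_sub u huK hlt
  have hlen₀ := hLV.le_len _ hn₀.1
  have hlen₂ := hLV.le_len _ hm₂.1
  have ht_len : t ≤ len L m₂ := by
    have := mul_le_mul_of_long he ht hte hD hlen₂ heD le_rfl
    exact le_of_mul_le_mul_right this he
  have hfit₀ : t * (-det m₂ m₀) ≤ (len K u - len K (-u)) * det u m₀ :=
    mul_le_mul_of_long he ht hte hD hlong hf₀D hd₀e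
  have hfit₀' : t * (-det m₂ n₀) ≤ (len K u - len K (-u)) * det u n₀ :=
    mul_le_mul_of_long he ht hte hD hlong hf₀D' hd₀e'
  have hheight : t * det m₂ u ≤ len L n₀ * det u n₀ :=
    mul_le_mul_of_long he ht hte hD hlen₀ hd₂D hd₀e'
  have hwidth : t * det m₂ u ≤ dot (p - w) u := by
    have hE := (hn₀.isLast hb).sub_mem hL hn₀.1.2.1 (len_nonneg hL) le_rfl
    have h3 := hq.dot_le hE
    have h4 := dot_eq_of_mem_supportSet hb.1 hx.1
    rw [dot_neg_right, dot_neg_right] at h4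
    rw [hpq, dot_sub_left]
    rw [dot_sub_left, dot_smul_left, dot_rot_left, det_swap u n₀] at h3
    linarith
  -- The vectors `B i` lead from the last point of the edge `-u` to the lattice points of one row;
  -- `B 0` is `t` steps along the edge of `L` with normal `m₂`.
  set B : ℤ → ℤ × ℤ := fun i => i • rot u + t • rot m₂ with hB
  have hBdot : ∀ i v, dot (B i) v = i * det u v + t * det m₂ v := fun i v => by
    simp only [hB, dot_add_left, dot_smul_left, dot_rot_left]
  have hBu : ∀ i, dot (B i) u = t * det m₂ u := fun i => by
    rw [hBdot, det_self]; ring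
  have hr : 0 < t * det m₂ u := mul_pos ht hd₂
  -- the top caps have the same cardinality
  have fitL : ∀ j, 0 ≤ (j - len L (-u)) * det u n₀ + t * det m₂ n₀ → j ≤ len L u →
      covariogram L (q - x + -B j) = (cap L u x (t * det m₂ u)).card := fun j hj hjl => by
    have := covariogram_eq_card_cap (y := -B j) hL hu hn₀ hm₂ hq hx ?_ ?_ ?_
    · rw [this, dot_neg_left, neg_neg, hBu]
    · rw [dot_add_left, dot_neg_left, hBdot, dot_smul_left, dot_rot_left]
      linarith
    · rw [dot_add_left, dot_neg_left, hBdot, dot_smul_left, dot_rot_left, det_self, hum₂]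
      nlinarith
    · rw [dot_add_left, dot_neg_left, hBu, ← hpq]
      linarith
  have capK : covariogram K (p - w + -B (len K u)) = (cap K u w (t * det m₂ u)).card := by
    have := covariogram_eq_card_cap (y := -B (len K u)) hK hu hm₀ hm₃ hp hw ?_ ?_ ?_
    · rw [this, dot_neg_left, neg_neg, hBu]
    · rw [dot_add_left, dot_neg_left, hBdot, dot_smul_left, dot_rot_left]
      linarith
    · rw [dot_add_left, dot_neg_left, hBdot, dot_smul_left, dot_rot_left]
      nlinarith
    · rw [dot_add_left, dot_neg_left, hBu]
      linarith
  have capEq : (cap K u w (t * det m₂ u)).card = (cap L u x (t * det m₂ u)).card := by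
    rw [← capK, hg, hpq, h₁]
    exact fitL _ (by rw [← h₁, ← h₂]; linarith) le_rfl
  -- the caps of one row less
  have capLe : (cap K u w (t * det m₂ u - 1)).card ≤ (cap L u x (t * det m₂ u - 1)).card := by
    obtain ⟨ν, hν⟩ := exists_dot_eq_one hu
    have hνrel := dot_mul_det ν m₀ m₃ u
    have hprel := det_mul_det m₂ m₀ m₃ u
    rw [hν, one_mul, hum₃, det_swap u m₀] at hνrel
    rw [hum₃, det_swap u m₀] at hprel
    -- The vector `ν` lowers the cap by one row, and the two bounds on `i` are the fitting
    -- conditions at `m₀` and `m₃`. They leave an interval of length at least one, by `h6` below.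
    -- For `L` no fitting is needed, since the cap bounds the covariogram anyway.
    obtain ⟨i, hi₁, hi₂⟩ := exists_int_between
      (X := len K (-u) * det u m₀ - t * det m₂ m₀ + dot ν m₀)
      (Y := len K u * det m₃ u + t * det m₂ m₃ - dot ν m₃) hd₀ (b := det m₃ u) (by
        have h5 : 0 < det u m₀ * det m₃ u := mul_pos hd₀ hd₃
        have h6 : (len K u * det m₃ u + t * det m₂ m₃ - dot ν m₃) * det u m₀ -
            (len K (-u) * det u m₀ - t * det m₂ m₀ + dot ν m₀) * det m₃ u =
            (len K u - len K (-u)) * (det u m₀ * det m₃ u) -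
              (t * det m₂ u - 1) * det m₀ m₃ := by
          linear_combination t * hprel - hνrel
        rw [h6]
        rcases le_or_gt (det m₀ m₃) 0 with h7 | h7
        · have h8 : 0 ≤ (t * det m₂ u - 1) * -det m₀ m₃ :=
            mul_nonneg (by linarith) (by linarith)
          have h9 : 1 * (det u m₀ * det m₃ u) ≤
              (len K u - len K (-u)) * (det u m₀ * det m₃ u) :=
            mul_le_mul_of_nonneg_right (by linarith) h5.le
          linarith
        · have h8 := mul_le_mul_of_nonneg_right hfit₀ hd₃.le
          have h9 := mul_le_mul_of_nonneg_right ht₁.le hd₀.le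
          have h10 : t * -det m₂ m₀ * det m₃ u =
              t * det m₂ u * det m₀ m₃ + t * det m₂ m₃ * det u m₀ := by
            linear_combination (-t) * hprel
          linarith) hd₃
    have hy : -dot (-B i + ν) u = t * det m₂ u - 1 := by
      rw [dot_add_left, dot_neg_left, hBu, hν]; ring
    have h5 := covariogram_eq_card_cap (y := -B i + ν) hK hu hm₀ hm₃ hp hw ?_ ?_ ?_
    · have h6 := covariogram_le_card_cap (y := -B i + ν) (w₂ := x) hq
      rw [hy] at h5 h6
      rw [← h5, hg, hpq]
      exact h6
    · simp only [dot_add_left, dot_neg_left, hBdot, dot_smul_left, dot_rot_left]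
      linarith
    · simp only [dot_add_left, dot_neg_left, hBdot, dot_smul_left, dot_rot_left, hum₃]
      linarith
    · rw [dot_add_left, dot_add_left, dot_neg_left, hBu, hν]
      linarith
  have hrow : (L.filter fun z => dot (z - x) u = t * det m₂ u).card ≤
      (K.filter fun z => dot (z - w) u = t * det m₂ u).card := by
    have h5 := card_cap_eq K u w (t * det m₂ u)
    have h6 := card_cap_eq L u x (t * det m₂ u)
    omega
  -- the top row of `K`
  have hBinj : ∀ i j y, y + B i = y + B j → i = j := fun i j y hij =>
    smul_rot_injective hu0 (add_right_cancel (add_left_cancel hij))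
  have rowK : ∀ z ∈ K.filter (fun z => dot (z - w) u = t * det m₂ u), ∃ i : ℤ, z = w + B i ∧
      2 ≤ i ∧ (i - len K (-u)) * det u m₀ + t * det m₂ m₀ ≤ 0 := fun z hz => by
    obtain ⟨hzK, hzu⟩ := Finset.mem_filter.1 hz
    obtain ⟨i, hi⟩ := exists_smul_rot (d := z - w - t • rot m₂) hu (by
      rw [dot_sub_left, hzu, dot_smul_left, dot_rot_left, sub_self])
    have hzi : z = w + B i := by
      rw [hB]; simp only; rw [← hi]; abel
    refine ⟨i, hzi, ?_, ?_⟩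
    · have h5 := (hm₃.isFirst hw).dot_le hzK
      rw [hzi, dot_add_left, hBdot, hum₃] at h5
      have h6 : det m₃ u < i * det m₃ u := by linarith
      by_contra h7
      nlinarith
    · have h5 := (hm₀.isLast ha).dot_le hzK
      have e1 := last_eq_first_add hK (gcd_neg hu) ha hw
      rw [rot_neg, smul_neg] at e1
      rw [hzi, dot_add_left, hBdot, e1, dot_add_left, dot_neg_left, dot_smul_left,
        dot_rot_left] at h5
      linarith
  have rowL_ne : (L.filter fun z => dot (z - x) u = t * det m₂ u).Nonempty := by
    refine ⟨x + t • rot m₂, Finset.mem_filter.2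
      ⟨(hm₂.isFirst hx).add_mem hL hm₂.1.2.1 ht.le ht_len, ?_⟩⟩
    rw [add_sub_cancel_left, dot_smul_left, dot_rot_left]
  obtain ⟨z, hz, hzmax⟩ := (K.filter fun z => dot (z - w) u = t * det m₂ u).exists_max_image
    (det u) (Finset.card_pos.1 (rowL_ne.card_pos.trans_le hrow))
  obtain ⟨k, rfl, hk₂, hk₀⟩ := rowK z hz
  have hrowK : ((K.filter fun z => dot (z - w) u = t * det m₂ u).card : ℤ) ≤ k - 1 := by
    have hsub : (K.filter fun z => dot (z - w) u = t * det m₂ u) ⊆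
        (Finset.Icc 2 k).image fun i => w + B i := fun z hz => by
      obtain ⟨i, rfl, hi₂, -⟩ := rowK z hz
      refine Finset.mem_image_of_mem _ (Finset.mem_Icc.2 ⟨hi₂, ?_⟩)
      have h5 := hzmax _ hz
      simp only [hB, det_add_right, det_smul_right, det_rot_right] at h5
      have h6 := dot_self_pos hu0
      by_contra h7
      nlinarith
    have h5 := (Finset.card_le_card hsub).trans Finset.card_image_le
    rw [Int.card_Icc] at h5
    omega
  -- Let `k` be the last index in the row of `K`, which therefore has at most `k - 1` points. If
  -- index `k - 1` is not cut off by `n₀`, the row of `L` contains the `k` indices from 0 to `k -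
  -- 1`, too many.
  rcases le_or_gt (((k - 1) - len L (-u)) * det u n₀ + t * det m₂ n₀) 0 with hj | hj
  · have hsub : ((Finset.Icc 0 (k - 1)).image fun i => x + B i) ⊆
        L.filter (fun z => dot (z - x) u = t * det m₂ u) := fun z hz => by
      obtain ⟨i, hi, rfl⟩ := Finset.mem_image.1 hz
      rw [Finset.mem_Icc] at hi
      refine Finset.mem_filter.2 ⟨row_mem hL hu hn₀ hm₂ hb hx hi.1 ht.le ht_len hheight ?_, ?_⟩
      · nlinarith
      · rw [add_sub_cancel_left, hBu]
    have h5 := Finset.card_le_card hsub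
    rw [Finset.card_image_of_injective _ (fun i j hij => hBinj i j x hij), Int.card_Icc] at h5
    omega
  · have hkl : k ≤ len K u := by
      have h5 : (k - len K (-u)) * det u m₀ ≤ (len K u - len K (-u)) * det u m₀ := by linarith
      have h6 := le_of_mul_le_mul_right h5 hd₀
      linarith
    -- Otherwise the translation belonging to index `k - 1` fits in `L` and attains the size of the
    -- cap. In `K` it sends the cap point with index `k` to `p + rot u`, just beyond the edge `u`,
    -- and so falls short of that size.
    have h5 := fitL (k - 1) hj.le (by rw [← h₁]; linarith)
    have h6 := covariogram_lt_card_cap (y := -B (k - 1)) (w₂ := w) (z := w + B k) hp ?_ ?_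
    · rw [dot_neg_left, neg_neg, hBu, hg, hpq, h5, capEq] at h6
      exact lt_irrefl _ h6
    · refine Finset.mem_filter.2 ⟨(Finset.mem_filter.1 hz).1, ?_⟩
      rw [add_sub_cancel_left, dot_neg_left, neg_neg, hBu, hBu]
    · have h7 : w + B k + (p - w + -B (k - 1)) = p + rot u := by
        simp only [hB, sub_smul, one_smul]; abel
      rw [h7]
      exact hp.add_rot_notMem hu0

theorem HasLongEdges.mirror {V K : Finset (ℤ × ℤ)} {e D : ℤ} (h : HasLongEdges V e D K) :
    HasLongEdges (mirror V) e D (mirror K) where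
  pos := h.pos
  gcd_eq_one w hw := by
    have h1 := h.gcd_eq_one (mir w) (mem_mirror.1 hw)
    rwa [mir, Int.gcd_comm] at h1
  neg_mem w hw := mem_mirror.2 (h.neg_mem (mir w) (mem_mirror.1 hw))
  le_det v hv w hw hpos := by
    have h1 : det v w = det (mir w) (mir v) := by rw [det_mir, ← det_swap]
    rw [h1] at hpos ⊢
    exact h.le_det (mir w) (mem_mirror.1 hw) (mir v) (mem_mirror.1 hv) hpos
  det_le v hv w hw := by
    have h1 : det v w = det (mir w) (mir v) := by rw [det_mir, ← det_swap]
    rw [h1]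
    exact h.det_le (mir w) (mem_mirror.1 hw) (mir v) (mem_mirror.1 hv)
  mem w hw := mem_mirror.2 (h.mem (mir w) (mem_edgeNormals_mirror.1 hw))
  le_len w hw := by
    rw [len_mirror]
    exact h.le_len (mir w) (mem_edgeNormals_mirror.1 hw)
  le_len_sub w hw := by
    rw [len_mirror, len_mirror]
    exact h.le_len_sub (mir w) (mem_edgeNormals_mirror.1 hw)

theorem HasLongEdges.neg {V K : Finset (ℤ × ℤ)} {e D : ℤ} (h : HasLongEdges V e D K) :
    HasLongEdges V e D (-K) where
  pos := h.pos
  gcd_eq_one := h.gcd_eq_one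
  neg_mem := h.neg_mem
  le_det := h.le_det
  det_le := h.det_le
  mem w hw := by
    have := h.neg_mem _ (h.mem _ (mem_edgeNormals_neg.1 hw))
    rwa [neg_neg] at this
  le_len w hw := by
    rw [len_neg]
    exact h.le_len _ (mem_edgeNormals_neg.1 hw)
  le_len_sub w hw := by
    rw [len_neg, len_neg]
    exact h.le_len_sub _ (mem_edgeNormals_neg.1 hw)

theorem HasLongEdges.shift {V K : Finset (ℤ × ℤ)} {e D : ℤ} (h : HasLongEdges V e D K)
    (t : ℤ × ℤ) : HasLongEdges V e D (shift t K) where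
  pos := h.pos
  gcd_eq_one := h.gcd_eq_one
  neg_mem := h.neg_mem
  le_det := h.le_det
  det_le := h.det_le
  mem w hw := h.mem _ (by rwa [edgeNormals_shift] at hw)
  le_len w hw := by
    rw [len_shift]
    exact h.le_len _ (by rwa [edgeNormals_shift] at hw)
  le_len_sub w hw := by
    rw [len_shift, len_shift]
    exact h.le_len_sub _ (by rwa [edgeNormals_shift] at hw)

/-! ### Agreement of neighbouring edges and of boundary chains -/

section neighbours

variable {K L V : Finset (ℤ × ℤ)} {e D : ℤ}

theorem isNext_eq (hK : IsLatticePolygon K)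
    (hL : IsLatticePolygon L) (hKV : HasLongEdges V e D K) (hLV : HasLongEdges V e D L)
    (hg : covariogram K = covariogram L) {u m₂ m₃ : ℤ × ℤ} (hu : Int.gcd u.1 u.2 = 1)
    (h₁ : len K u = len L u) (h₂ : len K (-u) = len L (-u)) (hlt : len K (-u) < len K u)
    (hm₃ : IsNext K (-u) m₃) (hm₂ : IsNext L (-u) m₂) : m₃ = m₂ := by
  have h3 := not_det_pos_of_isNext hK hL hKV hLV hg hu h₁ h₂ hlt hm₃ hm₂
  have h4 := not_det_pos_of_isNext hL hK hLV hKV hg.symm hu h₁.symm h₂.symm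
    (by rwa [← h₁, ← h₂]) hm₂ hm₃
  rw [det_swap] at h4
  rcases eq_or_eq_neg_of_det_eq_zero hm₂.1.2.1 hm₃.1.2.1 (by linarith : det m₂ m₃ = 0) with h | h
  · exact h
  · have h5 := hm₃.2.1
    rw [h, det_neg_right] at h5
    linarith [hm₂.2.1]

theorem isPrev_eq (hK : IsLatticePolygon K)
    (hL : IsLatticePolygon L) (hKV : HasLongEdges V e D K) (hLV : HasLongEdges V e D L)
    (hg : covariogram K = covariogram L) {u m₂ m₃ : ℤ × ℤ} (hu : Int.gcd u.1 u.2 = 1)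
    (h₁ : len K u = len L u) (h₂ : len K (-u) = len L (-u)) (hlt : len K (-u) < len K u)
    (hm₃ : IsPrev K (-u) m₃) (hm₂ : IsPrev L (-u) m₂) : m₃ = m₂ := by
  have hg' : covariogram (mirror K) = covariogram (mirror L) := by
    funext x
    rw [covariogram_mirror, covariogram_mirror, hg]
  have e1 : ∀ K', len (mirror K') (mir u) = len K' u := fun K' => by rw [len_mirror, mir_mir]
  have e2 : ∀ K', len (mirror K') (-mir u) = len K' (-u) := fun K' => by rw [len_mirror]; rfl
  refine mir_injective (isNext_eq hK.mirror hL.mirror hKV.mirror hLV.mirror hg' (gcd_mir hu)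
    ?_ ?_ ?_ hm₃.mirror hm₂.mirror)
  · rw [e1, e1, h₁]
  · rw [e2, e2, h₂]
  · rw [e1, e2]; exact hlt

theorem det_pos_of_between_of_between {u v w x : ℤ × ℤ} (huv : 0 < det u v) (huw : 0 < det u w)
    (hwv : 0 < det w v) (hux : 0 < det u x) (hxw : 0 < det x w) : 0 < det x v := by
  have h1 := det_mul_det x u w v
  rw [det_swap u x, det_swap w v] at h1
  have h2 := mul_pos hux hwv
  have h3 := mul_pos hxw huv
  have h4 : 0 < det x v * det u w := by rw [h1]; linarith
  exact pos_of_mul_pos_left h4 huw.le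

/-- Chains with equal edge lengths agree up to a translation. -/
theorem chain_eq (hK : IsLatticePolygon K) (hL : IsLatticePolygon L)
    (hV : ∀ w ∈ V, Int.gcd w.1 w.2 = 1) (hKV : ∀ w ∈ edgeNormals K, w ∈ V)
    (hLV : ∀ w ∈ edgeNormals L, w ∈ V) {u v p q p' q' : ℤ × ℤ} (huv : 0 < det u v)
    (hlen : ∀ w ∈ V, 0 < det u w → 0 < det w v → len K w = len L w) (hp : IsLast K u p)
    (hq : IsFirst K v q) (hp' : IsLast L u p') (hq' : IsFirst L v q') : q - p = q' - p' := by
  rw [first_sub_last_eq_sum hK hV hKV _ rfl huv hp hq,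
    first_sub_last_eq_sum hL hV hLV _ rfl huv hp' hq']
  refine Finset.sum_congr rfl fun w hw => ?_
  obtain ⟨h1, h2, h3⟩ := Finset.mem_filter.1 hw
  rw [hlen w h1 h2 h3]

end neighbours

/-- Points of `A` in `S` are reflected to `κ - z` and the others are kept. By `h₃` no reflection of
a point of `A` lies in `S`, so a reflected point never meets a kept one; for the same reason, and
since `c ∉ A`, the value `κ - c` is missed. -/
theorem card_lt_card_of_reflection {A B : Finset (ℤ × ℤ)} {c κ : ℤ × ℤ} (S : ℤ × ℤ → Prop)
    (h₁ : ∀ z ∈ A, ¬ S z → z ∈ B) (h₂ : ∀ z ∈ A, S z → κ - z ∈ B) (h₃ : ∀ z ∈ A, ¬ S (κ - z))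
    (hc : c ∉ A) (hcB : κ - c ∈ B) (hcS : S c) : A.card < B.card := by
  classical
  have hle : A.card ≤ (B.erase (κ - c)).card := by
    refine Finset.card_le_card_of_injOn (fun z => if S z then κ - z else z) ?_ ?_
    · intro z hz
      simp only [Finset.mem_coe] at hz ⊢
      split_ifs with h
      · refine Finset.mem_erase.2 ⟨fun heq => hc ?_, h₂ z hz h⟩
        rwa [← sub_right_injective heq]
      · refine Finset.mem_erase.2 ⟨fun heq => h₃ z hz ?_, h₁ z hz h⟩
        rw [heq, sub_sub_cancel]
        exact hcS
    · intro y hy z hz heq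
      simp only [Finset.mem_coe] at hy hz heq
      split_ifs at heq with h h' h'
      · exact sub_right_injective heq
      · exact absurd (by rw [← heq, sub_sub_cancel]; exact h) (h₃ z hz)
      · exact absurd (by rw [heq, sub_sub_cancel]; exact h') (h₃ y hy)
      · exact heq
  exact hle.trans_lt (Finset.card_erase_lt_of_mem hcB)

/-- The weak sector from `u` to `v`, restricted to the directions in `V`. -/
def sector (V : Finset (ℤ × ℤ)) (u v : ℤ × ℤ) : Set (ℤ × ℤ) :=
  {w | w = u ∨ w = v ∨ (w ∈ V ∧ 0 < det u w ∧ 0 < det w v)}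

theorem det_of_mem_sector {V : Finset (ℤ × ℤ)} {u v w : ℤ × ℤ} (huv : 0 < det u v)
    (hw : w ∈ sector V u v) : 0 ≤ det u w ∧ 0 ≤ det w v := by
  rcases hw with rfl | rfl | ⟨-, h1, h2⟩
  · exact ⟨(det_self _).ge, huv.le⟩
  · exact ⟨huv.le, (det_self _).ge⟩
  · exact ⟨h1.le, h2.le⟩

/-- Every direction in `V` lies in the sector from `u` to `v`, in the opposite one, or in one of
the two open arcs in between. -/
theorem sector_cases {V : Finset (ℤ × ℤ)} {u v w : ℤ × ℤ} (hu : Int.gcd u.1 u.2 = 1)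
    (hv : Int.gcd v.1 v.2 = 1) (hV : ∀ w ∈ V, Int.gcd w.1 w.2 = 1) (hneg : ∀ w ∈ V, -w ∈ V)
    (hw : w ∈ V) : w ∈ sector V u v ∨ -w ∈ sector V u v ∨
      (0 < det v w ∧ 0 < det u w) ∨ (det v w < 0 ∧ det u w < 0) := by
  rcases lt_trichotomy (det u w) 0 with h1 | h1 | h1
  · rcases lt_trichotomy (det v w) 0 with h2 | h2 | h2
    · exact Or.inr (Or.inr (Or.inr ⟨h2, h1⟩))
    · rcases eq_or_eq_neg_of_det_eq_zero hv (hV w hw) h2 with rfl | rfl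
      · exact Or.inl (Or.inr (Or.inl rfl))
      · exact Or.inr (Or.inl (Or.inr (Or.inl (neg_neg _))))
    · refine Or.inr (Or.inl (Or.inr (Or.inr ⟨hneg w hw, ?_, ?_⟩)))
      · rw [det_neg_right]; linarith
      · rw [det_neg_left, ← det_swap]; exact h2
  · rcases eq_or_eq_neg_of_det_eq_zero hu (hV w hw) h1 with rfl | rfl
    · exact Or.inl (Or.inl rfl)
    · exact Or.inr (Or.inl (Or.inl (neg_neg _)))
  · rcases lt_trichotomy (det v w) 0 with h2 | h2 | h2
    · exact Or.inl (Or.inr (Or.inr ⟨hw, h1, by rw [det_swap]; linarith⟩))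
    · rcases eq_or_eq_neg_of_det_eq_zero hv (hV w hw) h2 with rfl | rfl
      · exact Or.inl (Or.inr (Or.inl rfl))
      · exact Or.inr (Or.inl (Or.inr (Or.inl (neg_neg _))))
    · exact Or.inr (Or.inr (Or.inl ⟨h2, h1⟩))

/-! ### Switching edge lengths -/

/-- The edges of `K` and `L` with normals `±u` agree, those with normals `±v` are interchanged, and
those in between have the lengths of their opposites. The two sets are placed so that their vertices
after the edge with normal `u` coincide. -/
structure IsSwitch (K L V : Finset (ℤ × ℤ)) (e D : ℤ) (u v p p' q q' : ℤ × ℤ) : Prop where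
  polygon_left : IsLatticePolygon K
  polygon_right : IsLatticePolygon L
  long_left : HasLongEdges V e D K
  long_right : HasLongEdges V e D L
  covariogram_eq : covariogram K = covariogram L
  gcd_left : Int.gcd u.1 u.2 = 1
  gcd_right : Int.gcd v.1 v.2 = 1
  det_pos : 0 < det u v
  len_left : len K u = len L u
  len_neg_left : len K (-u) = len L (-u)
  lt_left : len K (-u) < len K u
  len_right : len L v = len K (-v)
  len_neg_right : len L (-v) = len K v
  lt_right : len K (-v) < len K v
  between : ∀ w ∈ V, 0 < det u w → 0 < det w v →
    len K w = len K (-w) ∧ len L w = len K w ∧ len L (-w) = len K w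
  last_left : IsLast K u p
  last_left' : IsLast L u p
  last_neg_left : IsLast K (-u) p'
  last_neg_left' : IsLast L (-u) p'
  first_right : IsFirst K v q
  first_right' : IsFirst L v q
  first_neg_right : IsFirst K (-v) q'
  first_neg_right' : IsFirst L (-v) q'
  add_eq : p + p' = q + q'

/-- The point `f` of `L` and its reflection are maximal on `K` in direction `w` and `-w`. -/
structure IsOppositeFace (K L : Finset (ℤ × ℤ)) (κ w f : ℤ × ℤ) : Prop where
  mem : f ∈ L
  sub_mem : κ - f ∈ L
  dot_le : ∀ y ∈ K, dot y w ≤ dot f w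
  dot_neg_le : ∀ y ∈ K, dot y (-w) ≤ dot (κ - f) (-w)

/-- The pairs `(z, y)` that satisfy the inequalities of the faces in a sector. -/
def Fits (K L V : Finset (ℤ × ℤ)) (u v κ z y : ℤ × ℤ) : Prop :=
  ∀ w ∈ sector V u v, ∀ f, IsOppositeFace K L κ w f →
    dot z w ≤ dot f w ∧ dot y (-w) ≤ dot (κ - f) (-w)

theorem Fits.symm {K L V : Finset (ℤ × ℤ)} {u v κ z y : ℤ × ℤ} (h : Fits K L V u v κ z y) :
    Fits K L V u v κ (κ - y) (κ - z) := fun w hw f hf => by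
  obtain ⟨h1, h2⟩ := h w hw f hf
  simp only [dot_sub_left, dot_neg_right] at h2 ⊢
  constructor <;> linarith

theorem Fits.of_mem {K L V : Finset (ℤ × ℤ)} {u v κ z y : ℤ × ℤ} (hz : z ∈ K) (hy : y ∈ K) :
    Fits K L V u v κ z y :=
  fun _ _ _ hf => ⟨hf.dot_le z hz, hf.dot_neg_le y hy⟩

namespace IsSwitch

variable {K L V : Finset (ℤ × ℤ)} {e D : ℤ} {u v p p' q q' : ℤ × ℤ}

section faces

variable (h : IsSwitch K L V e D u v p p' q q')
include h

theorem dot_add_eq (w : ℤ × ℤ) : dot p w + dot p' w = dot q w + dot q' w := by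
  rw [← dot_add_left, h.add_eq, dot_add_left]

theorem mem_left : u ∈ V :=
  h.long_left.mem _ (mem_edgeNormals.2 ⟨h.gcd_left, (len_nonneg h.polygon_left).trans_lt h.lt_left⟩)

theorem edge_right : v ∈ edgeNormals K :=
  mem_edgeNormals.2 ⟨h.gcd_right, (len_nonneg h.polygon_left).trans_lt h.lt_right⟩

theorem mem_right : v ∈ V := h.long_left.mem _ h.edge_right

theorem isOppositeFace_left : IsOppositeFace K L (p + p') u p := by
  refine ⟨h.last_left'.mem, ?_, fun y hy => h.last_left.dot_le hy, ?_⟩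
  · rw [add_sub_cancel_left]; exact h.last_neg_left'.mem
  · rw [add_sub_cancel_left]; exact fun y hy => h.last_neg_left.dot_le hy

theorem isOppositeFace_right : IsOppositeFace K L (p + p') v q := by
  refine ⟨h.first_right'.mem, ?_, fun y hy => h.first_right.dot_le hy, ?_⟩
  · rw [h.add_eq, add_sub_cancel_left]; exact h.first_neg_right'.mem
  · rw [h.add_eq, add_sub_cancel_left]; exact fun y hy => h.first_neg_right.dot_le hy

/-- The edges strictly between `u` and `w` have the same lengths in `K`, `L`, `-K` and `-L`. The
chains from the common vertex `p`, and from `p'` after reflection, therefore end at the same vertex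
and at its mirror image. -/
theorem exists_isOppositeFace {w : ℤ × ℤ} (hw : w ∈ sector V u v) :
    ∃ f, IsOppositeFace K L (p + p') w f := by
  rcases hw with rfl | rfl | ⟨hwV, huw, hwv⟩
  · exact ⟨p, h.isOppositeFace_left⟩
  · exact ⟨q, h.isOppositeFace_right⟩
  obtain ⟨a, ha⟩ := exists_isFirst h.polygon_left.nonempty w
  obtain ⟨a', ha'⟩ := exists_isFirst h.polygon_left.nonempty (-w)
  obtain ⟨b, hb⟩ := exists_isFirst h.polygon_right.nonempty w
  obtain ⟨b', hb'⟩ := exists_isFirst h.polygon_right.nonempty (-w)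
  have hV := h.long_left.gcd_eq_one
  have hbtw : ∀ x ∈ V, 0 < det u x → 0 < det x w →
      len K x = len K (-x) ∧ len L x = len K x ∧ len L (-x) = len K x := fun x hx h1 h2 =>
    h.between x hx h1 (det_pos_of_between_of_between h.det_pos huw hwv h1 h2)
  have e1 := chain_eq h.polygon_left h.polygon_right hV h.long_left.mem h.long_right.mem huw
    (fun x hx h1 h2 => (hbtw x hx h1 h2).2.1.symm) h.last_left ha h.last_left' hb
  have e2 := chain_eq h.polygon_left h.polygon_left.neg hV h.long_left.mem h.long_left.neg.mem huw
    (fun x hx h1 h2 => by rw [len_neg]; exact (hbtw x hx h1 h2).1) h.last_left ha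
    (by simpa using h.last_neg_left.neg) (by simpa using ha'.neg)
  have e3 := chain_eq h.polygon_left h.polygon_right.neg hV h.long_left.mem h.long_right.neg.mem
    huw (fun x hx h1 h2 => by rw [len_neg]; exact (hbtw x hx h1 h2).2.2.symm) h.last_left ha
    (by simpa using h.last_neg_left'.neg) (by simpa using hb'.neg)
  have e4 : a = b := sub_left_injective e1
  have e5 : p + p' - a = a' := by
    have : a' = p + p' - a + (a - p - (-a' - -p')) := by abel
    rw [this, e2, sub_self, add_zero]
  have e6 : p + p' - a = b' := by
    have : b' = p + p' - a + (a - p - (-b' - -p')) := by abel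
    rw [this, e3, sub_self, add_zero]
  refine ⟨a, e4 ▸ hb.mem, e6 ▸ hb'.mem, fun y hy => ha.dot_le hy, fun y hy => ?_⟩
  rw [e5]
  exact ha'.dot_le hy

theorem fits_left {z y : ℤ × ℤ} (hzy : Fits K L V u v (p + p') z y) :
    dot z u ≤ dot p u ∧ dot y (-u) ≤ dot p' (-u) := by
  have := hzy u (Or.inl rfl) p h.isOppositeFace_left
  rwa [add_sub_cancel_left] at this

theorem fits_right {z y : ℤ × ℤ} (hzy : Fits K L V u v (p + p') z y) :
    dot z v ≤ dot q v ∧ dot y (-v) ≤ dot q' (-v) := by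
  have := hzy v (Or.inr (Or.inl rfl)) q h.isOppositeFace_right
  rwa [h.add_eq, add_sub_cancel_left] at this

/-- The case `t = 1` of `mul_le_mul_of_long`: a single edge of `L` already spans more than any
determinant between directions in `V`. -/
theorem mul_det_le {w a b c d : ℤ × ℤ} (hw : w ∈ edgeNormals L) (ha : a ∈ V) (hb : b ∈ V)
    (hc : c ∈ V) (hd : d ∈ V) (hcd : 0 < det c d) : det a b ≤ len L w * det c d := by
  have he := h.long_left.pos
  have huv := h.long_left.le_det u h.mem_left v h.mem_right h.det_pos
  have hD := h.long_left.det_le u h.mem_left v h.mem_right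
  have := mul_le_mul_of_long (t := 1) he one_pos (by linarith) (by linarith)
    (h.long_right.le_len w hw) (h.long_left.det_le a ha b hb) (h.long_left.le_det c hc d hd hcd)
  linarith

end faces

/-! ### The critical translation -/

section translate

variable (h : IsSwitch K L V e D u v p p' q q')
include h

/-- The points `q + (len K (-v) + 1) • rot v` and `p - (len K (-u) + 1) • rot u` lie on the long
edges `v` and `u` of `K`, hence above the lines of `-u` and `-v`. This gives the claim for `u` and
`v`, since `q - p' = p - q'`, and then for their cone. -/
theorem dot_translate_nonneg {w : ℤ × ℤ} (hw : w ∈ sector V u v) :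
    0 ≤ dot (q - p' - (len K (-u) + 1) • rot u + (len K (-v) + 1) • rot v) w := by
  have hc := h.first_right.add_mem h.polygon_left h.gcd_right (i := len K (-v) + 1)
    (by linarith [len_nonneg h.polygon_left (u := -v)]) (by linarith [h.lt_right])
  have hd := h.last_left.sub_mem h.polygon_left h.gcd_left (i := len K (-u) + 1)
    (by linarith [len_nonneg h.polygon_left (u := -u)]) (by linarith [h.lt_left])
  have h1 := h.last_neg_left.dot_le hc
  have h2 := h.first_neg_right.dot_le hd
  have h3 := h.dot_add_eq v
  obtain ⟨h4, h5⟩ := det_of_mem_sector h.det_pos hw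
  have := dot_le_of_arc (z := 0) h.det_pos h4 h5
    (y := q - p' - (len K (-u) + 1) • rot u + (len K (-v) + 1) • rot v) ?_ ?_
  · simpa [dot] using this
  · simp only [dot_add_left, dot_sub_left, dot_smul_left, dot_rot_left, dot_neg_right,
      det_self] at h1 ⊢
    have : dot 0 u = 0 := by simp [dot]
    linarith
  · simp only [dot_add_left, dot_sub_left, dot_smul_left, dot_rot_left, dot_neg_right,
      det_self] at h2 ⊢
    have : dot 0 v = 0 := by simp [dot]
    linarith

variable {x z n m₀ : ℤ × ℤ}
  (hx : x = q - p' - (len K (-u) + 1) • rot u + (len K (-v) + 1) • rot v)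
include hx

/-- In the sector the common faces bound `z`; in the opposite sector the bound for `z - x` carries
over because `x` points upwards there. Between `v` and `-u` the far end of the edge `n` dominates,
that edge being long enough to reach the level imposed by `-u` on `z - x`. Between `-v` and `u` a
point of the edge `u` of `L` dominates. Thus `n` is the only additional condition. -/
theorem mem_of_fits (hn : IsNext L v n) (hz : Fits K L V u v (p + p') z (z - x))
    (hzn : dot z n ≤ dot (q + len K (-v) • rot v) n) : z ∈ L := by
  have hneg : ∀ w ∈ sector V u v, 0 ≤ dot x w := fun w hw => hx ▸ h.dot_translate_nonneg hw
  obtain ⟨b, hb⟩ := exists_isLast h.polygon_right.nonempty v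
  have hbq := last_eq_first_add h.polygon_right h.gcd_right h.first_right' hb
  rw [h.len_right] at hbq
  obtain ⟨hz1, hz2⟩ := h.fits_left hz
  obtain ⟨hz3, hz4⟩ := h.fits_right hz
  refine h.polygon_right.mem_of_forall_edge fun w hw => ?_
  rcases sector_cases h.gcd_left h.gcd_right h.long_right.gcd_eq_one h.long_right.neg_mem
    (h.long_right.mem w hw) with hs | hs | ⟨h1, h2⟩ | ⟨h1, h2⟩
  · obtain ⟨f, hf⟩ := h.exists_isOppositeFace hs
    exact ⟨f, hf.mem, (hz w hs f hf).1⟩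
  · obtain ⟨f, hf⟩ := h.exists_isOppositeFace hs
    have h3 := (hz _ hs f hf).2
    have h4 := hneg _ hs
    rw [neg_neg, dot_sub_left] at h3
    rw [dot_neg_right] at h4
    exact ⟨_, hf.sub_mem, by linarith⟩
  · have hnw := hn.2.2 w hw h1
    have hun := det_pos_of_between h1 hn.2.1 hnw h.det_pos h2
    have hE := (hn.isFirst hb).add_mem h.polygon_right hn.1.2.1 (len_nonneg h.polygon_right) le_rfl
    have h6 := h.mul_det_le hn.1 h.mem_left h.mem_right h.mem_left (h.long_right.mem n hn.1) hun
    have h7 := h.dot_add_eq u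
    rw [hbq] at hE
    refine ⟨_, hE, dot_le_of_arc (u := n) (v := -u) ?_ hnw ?_ ?_ ?_⟩
    · rw [det_neg_right, ← det_swap]; exact hun
    · rw [det_neg_right, ← det_swap]; exact h2.le
    · rw [dot_add_left, dot_smul_left, dot_rot_left, det_self]; linarith
    · simp only [hx, dot_add_left, dot_sub_left, dot_smul_left, dot_rot_left, dot_neg_right,
        det_self] at hz2 ⊢
      rw [det_swap u v, det_swap u n] at *
      linarith
  · have hC := h.last_left'.sub_mem h.polygon_right h.gcd_left (i := len K (-u) + 1)
      (by linarith [len_nonneg h.polygon_left (u := -u)]) (by linarith [h.lt_left, h.len_left])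
    have h7 := h.dot_add_eq v
    refine ⟨_, hC, dot_le_of_arc (u := -v) (v := u) ?_ ?_ ?_ ?_ ?_⟩
    · rw [det_neg_left, ← det_swap]; exact h.det_pos
    · rw [det_neg_left]; linarith
    · rw [det_swap]; linarith
    · simp only [hx, dot_add_left, dot_sub_left, dot_smul_left, dot_rot_left, dot_neg_right,
        det_self] at hz4 ⊢
      linarith
    · rw [dot_sub_left, dot_smul_left, dot_rot_left, det_self]; linarith

/-- The same argument for the translated point: the far end of the edge `m₀` and a point of the long
edge `-v` of `L` take over, and `m₀` is the only additional condition. -/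
theorem sub_mem_of_fits (hm : IsPrev L (-u) m₀) (hz : Fits K L V u v (p + p') z (z - x))
    (hzm : dot (z - x) m₀ ≤ dot (p' + len K (-u) • rot u) m₀) : z - x ∈ L := by
  have hneg : ∀ w ∈ sector V u v, 0 ≤ dot x w := fun w hw => hx ▸ h.dot_translate_nonneg hw
  obtain ⟨b, hb⟩ := exists_isFirst h.polygon_right.nonempty (-u)
  have hbq : b = p' + len K (-u) • rot u := by
    rw [last_eq_first_add h.polygon_right (gcd_neg h.gcd_left) hb h.last_neg_left',
      h.len_neg_left, rot_neg, smul_neg, neg_add_cancel_right]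
  obtain ⟨hz1, hz2⟩ := h.fits_left hz
  obtain ⟨hz3, hz4⟩ := h.fits_right hz
  refine h.polygon_right.mem_of_forall_edge fun w hw => ?_
  rcases sector_cases h.gcd_left h.gcd_right h.long_right.gcd_eq_one h.long_right.neg_mem
    (h.long_right.mem w hw) with hs | hs | ⟨h1, h2⟩ | ⟨h1, h2⟩
  · obtain ⟨f, hf⟩ := h.exists_isOppositeFace hs
    have h3 := (hz _ hs f hf).1
    have h4 := hneg _ hs
    exact ⟨_, hf.mem, by rw [dot_sub_left]; linarith⟩
  · obtain ⟨f, hf⟩ := h.exists_isOppositeFace hs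
    have h3 := (hz _ hs f hf).2
    rw [neg_neg] at h3
    exact ⟨_, hf.sub_mem, h3⟩
  · have hwu : 0 < det w (-u) := by rw [det_neg_right, ← det_swap]; exact h2
    have hwm := hm.2.2 w hw hwu
    have hvm : 0 < det v m₀ := by
      have h5 := det_mul_det v w (-u) m₀
      have h6 := mul_pos h1 hm.2.1
      have h8 : 0 < det v (-u) := by rw [det_neg_right, ← det_swap]; exact h.det_pos
      have h7 := mul_nonneg h8.le hwm
      exact pos_of_mul_pos_left (by linarith : 0 < det v m₀ * det w (-u)) hwu.le
    have hE := (hm.isLast hb).sub_mem h.polygon_right hm.1.2.1 (len_nonneg h.polygon_right) le_rfl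
    have h6 := h.mul_det_le hm.1 h.mem_left h.mem_right h.mem_right (h.long_right.mem _ hm.1) hvm
    rw [hbq] at hE
    refine ⟨_, hE, dot_le_of_arc (u := v) (v := m₀) hvm h1.le hwm ?_ ?_⟩
    · simp only [hx, dot_add_left, dot_sub_left, dot_smul_left, dot_rot_left, det_self]
      rw [det_swap v m₀]
      linarith
    · rw [dot_sub_left _ (_ • _), dot_smul_left, dot_rot_left, det_self]; linarith
  · have hC := h.first_neg_right'.add_mem h.polygon_right (gcd_neg h.gcd_right)
      (i := len K (-v) + 1) (by linarith [len_nonneg h.polygon_left (u := -v)])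
      (by linarith [h.lt_right, h.len_neg_right])
    have h7 := h.dot_add_eq u
    refine ⟨_, hC, dot_le_of_arc (u := -v) (v := u) ?_ ?_ ?_ ?_ ?_⟩
    · rw [det_neg_left, ← det_swap]; exact h.det_pos
    · rw [det_neg_left]; linarith
    · rw [det_swap]; linarith
    · simp only [dot_add_left, dot_smul_left, dot_rot_left, det_self]; linarith
    · simp only [hx, rot_neg, dot_add_left, dot_sub_left, dot_smul_left, dot_rot_left,
        dot_neg_left, det_self, smul_neg] at hz1 ⊢
      linarith

end translate

/-- The two corners of the parallelogram cannot be cut off at the same time. -/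
theorem not_cut_cut (h : IsSwitch K L V e D u v p p' q q') {z y n m₀ : ℤ × ℤ}
    (hn : IsNext L v n) (hn' : IsNext K (-v) (-n)) (hm : IsPrev K (-u) m₀) (hm' : IsPrev L (-u) m₀)
    (hz : Fits K L V u v (p + p') z y)
    (h1 : dot (p' + len K (-u) • rot u) m₀ < dot y m₀)
    (h2 : dot (q' - len K (-v) • rot v) (-n) < dot y (-n)) : False := by
  obtain ⟨-, hz2⟩ := h.fits_left hz
  obtain ⟨b, hb⟩ := exists_isFirst h.polygon_left.nonempty (-u)
  have hbq : b = p' + len K (-u) • rot u := by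
    rw [last_eq_first_add h.polygon_left (gcd_neg h.gcd_left) hb h.last_neg_left,
      rot_neg, smul_neg, neg_add_cancel_right]
  obtain ⟨a, ha⟩ := exists_isLast h.polygon_left.nonempty (-v)
  have haq := last_eq_first_add h.polygon_left (gcd_neg h.gcd_right) h.first_neg_right ha
  rw [rot_neg, smul_neg, ← sub_eq_add_neg] at haq
  have hvu : 0 < det v (-u) := by rw [det_neg_right, ← det_swap]; exact h.det_pos
  have hvm := hm.2.2 v h.edge_right hvu
  have hum : 0 < det u m₀ := det_pos_of_isPrev_neg hm
  -- If `m₀ = v`, the edges `v` and `-u` of `K` share a vertex; by the central symmetry of the arcs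
  -- the edge `u` would then be no longer than `-u`.
  rcases hvm.eq_or_lt with h0 | h0
  · have hmv : m₀ = v := by
      rcases eq_or_eq_neg_of_det_eq_zero h.gcd_right hm.1.2.1 h0.symm with e | e
      · exact e
      · rw [e, det_neg_right] at hum
        linarith [h.det_pos]
    have h3 := last_eq_first_add h.polygon_left h.gcd_right h.first_right (hmv ▸ hm.isLast hb)
    have hC := h.last_left.sub_mem h.polygon_left h.gcd_left (len_nonneg h.polygon_left) le_rfl
    have h4 := h.first_neg_right.dot_le hC
    have h5 := h.dot_add_eq v
    have h6 : dot b v = dot q v := by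
      rw [h3, dot_add_left, dot_smul_left, dot_rot_left, det_self]; ring
    rw [hbq] at h6
    simp only [dot_add_left, dot_sub_left, dot_smul_left, dot_rot_left, dot_neg_right] at h4 h6
    have h7 := mul_lt_mul_of_pos_right h.lt_left h.det_pos
    linarith
  · have hnm := hn.2.2 m₀ hm'.1 h0
    have hun := det_pos_of_between h0 hn.2.1 hnm h.det_pos hum
    have h3 := (hn'.isFirst ha).dot_le hb.mem
    rw [haq, hbq] at h3
    -- Here `-u` lies between `m₀` and `-n`, so a point beyond the vertex `b` in both of these
    -- directions is beyond it in direction `-u`, which `hz2` forbids.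
    have h4 := dot_mul_det (y - (p' + len K (-u) • rot u)) m₀ (-n) (-u)
    have h5 : dot (y - (p' + len K (-u) • rot u)) (-u) ≤ 0 := by
      simp only [dot_sub_left, dot_add_left, dot_smul_left, dot_rot_left, dot_neg_right,
        det_self] at hz2 ⊢
      linarith
    have h6 : 0 ≤ det m₀ (-n) := by rw [det_neg_right, ← det_swap]; exact hnm
    have h7 : 0 < det (-u) (-n) := by rw [det_neg_left, det_neg_right, neg_neg]; exact hun
    have h8 : 0 < det m₀ (-u) := hm.2.1
    have h9 : 0 < dot (y - (p' + len K (-u) • rot u)) m₀ := by rw [dot_sub_left]; linarith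
    have h10 : 0 < dot (y - (p' + len K (-u) • rot u)) (-n) := by rw [dot_sub_left]; linarith
    have h11 := mul_pos h9 h7
    have h12 := mul_pos h10 h8
    have h13 := mul_nonneg (neg_nonneg.2 h5) h6
    linarith

theorem elim (h : IsSwitch K L V e D u v p p' q q') : False := by
  have hu0 := ne_zero_of_gcd (gcd_neg h.gcd_left)
  have hv0 := ne_zero_of_gcd (gcd_neg h.gcd_right)
  obtain ⟨m₀, hm⟩ := exists_isPrev h.polygon_left hu0
  obtain ⟨m₁, hm'⟩ := exists_isPrev h.polygon_right hu0
  have hmm := isPrev_eq h.polygon_left h.polygon_right h.long_left h.long_right h.covariogram_eq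
    h.gcd_left h.len_left h.len_neg_left h.lt_left hm hm'
  obtain ⟨n', hn'⟩ := exists_isNext h.polygon_left hv0
  obtain ⟨n, hn⟩ := exists_isNext h.polygon_right (ne_zero_of_gcd h.gcd_right)
  -- The pair at `v` is reversed in `L`, hence kept in `-L`, so the neighbour comparison applies to
  -- `K` and `-L`.
  have hnn := isNext_eq h.polygon_left h.polygon_right.neg h.long_left h.long_right.neg
    (by rw [covariogram_neg, h.covariogram_eq]) h.gcd_right
    (by rw [len_neg, h.len_neg_right]) (by rw [len_neg, neg_neg, h.len_right]) h.lt_right hn'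
    hn.neg
  subst hmm hnn
  obtain ⟨a, ha⟩ := exists_isLast h.polygon_left.nonempty (-v)
  have haq := last_eq_first_add h.polygon_left (gcd_neg h.gcd_right) h.first_neg_right ha
  rw [rot_neg, smul_neg, ← sub_eq_add_neg] at haq
  obtain ⟨b, hb⟩ := exists_isFirst h.polygon_left.nonempty (-u)
  have hbq : b = p' + len K (-u) • rot u := by
    rw [last_eq_first_add h.polygon_left (gcd_neg h.gcd_left) hb h.last_neg_left,
      rot_neg, smul_neg, neg_add_cancel_right]
  have hu1 := len_nonneg h.polygon_left (u := -u)
  have hv1 := len_nonneg h.polygon_left (u := -v)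
  -- Translation by `x` takes `b + rot u`, one step off the edge `-u` of `K`, to `q + (len K (-v) +
  -- 1) • rot v`, which is on the edge `v` of `K` but one step off the edge `v` of `L`.
  obtain ⟨x, hx⟩ : ∃ x, x = q - p' - (len K (-u) + 1) • rot u + (len K (-v) + 1) • rot v := ⟨_, rfl⟩
  have hκ := h.add_eq
  have hrefl : ∀ z, dot (p + p' + x - z - x) (-n) = dot (p + p') (-n) + dot z n := fun z => by
    simp only [dot_add_left, dot_sub_left, dot_neg_right]; ring
  -- The reflection `z ↦ p + p' + x - z` exchanges the roles of a point and its translate by `-x`;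
  -- it turns the corner cut from `L` after `v` into the corner cut from `K` after `-v`.
  have hcorner : ∀ z, (dot (q + len K (-v) • rot v) n < dot z n ↔
      dot (q' - len K (-v) • rot v) (-n) < dot (p + p' + x - z - x) (-n)) := fun z => by
    rw [hrefl, h.add_eq]
    simp only [dot_add_left, dot_sub_left, dot_neg_right]
    constructor <;> intro _ <;> linarith
  have hlt : covariogram K x < covariogram L x := by
    rw [covariogram_apply, covariogram_apply]
    refine card_lt_card_of_reflection (c := q + (len K (-v) + 1) • rot v) (κ := p + p' + x)
      (fun z => dot (q + len K (-v) • rot v) n < dot z n) ?_ ?_ ?_ ?_ ?_ ?_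
    · intro z hz hzn
      obtain ⟨h1, h2⟩ := Finset.mem_filter.1 hz
      have hf : Fits K L V u v (p + p') z (z - x) := .of_mem h1 h2
      refine Finset.mem_filter.2 ⟨h.mem_of_fits hx hn hf (not_lt.1 hzn),
        h.sub_mem_of_fits hx hm' hf ?_⟩
      exact hbq ▸ (hm.isLast hb).dot_le h2
    · intro z hz hzn
      obtain ⟨h1, h2⟩ := Finset.mem_filter.1 hz
      have hf := (Fits.of_mem h1 h2 : Fits K L V u v (p + p') z (z - x)).symm
      have e1 : p + p' - (z - x) = p + p' + x - z := by abel
      have e2 : p + p' - z = p + p' + x - z - x := by abel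
      rw [e1, e2] at hf
      refine Finset.mem_filter.2 ⟨h.mem_of_fits hx hn hf ?_, h.sub_mem_of_fits hx hm' hf ?_⟩
      · rw [← not_lt, hcorner]
        have e3 : p + p' + x - (p + p' + x - z) - x = z - x := by abel
        rw [e3, not_lt]
        exact haq ▸ (hn'.isFirst ha).dot_le h2
      -- The reflected point could fail only by being cut off at `m₀` as well as at `-n`.
      · by_contra hcon
        exact h.not_cut_cut hn hn' hm hm' hf (not_le.1 hcon) ((hcorner z).1 hzn)
    · intro z hz
      obtain ⟨h1, h2⟩ := Finset.mem_filter.1 hz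
      rw [hcorner]
      have e3 : p + p' + x - (p + p' + x - z) - x = z - x := by abel
      rw [e3, not_lt]
      exact haq ▸ (hn'.isFirst ha).dot_le h2
    · intro hc
      have h2 := (Finset.mem_filter.1 hc).2
      have e1 : q + (len K (-v) + 1) • rot v - x = b + rot u := by
        rw [hx, hbq, add_smul (len K (-u)), one_smul]; abel
      rw [e1] at h2
      have h3 := hb.2 _ (mem_supportSet_of_dot_eq hb.1 h2 (by
        rw [dot_add_left, dot_rot_left, det_neg_right, det_self, neg_zero, add_zero]))
      rw [det_add_right, det_neg_left u (rot u), det_rot_right] at h3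
      linarith [dot_self_pos (ne_zero_of_gcd h.gcd_left)]
    -- The missed value lies on the edge `u` of `L`, and its translate by `-x` on the edge `-v` of
    -- `L`; both edges are long enough because each exceeds its opposite in `L` or in `K`,
    -- respectively.
    · have hC := h.last_left'.sub_mem h.polygon_right h.gcd_left (i := len K (-u) + 1)
        (by linarith) (by linarith [h.lt_left, h.len_left])
      have hC' := h.first_neg_right'.add_mem h.polygon_right (gcd_neg h.gcd_right)
        (i := len K (-v) + 1) (by linarith) (by linarith [h.lt_right, h.len_neg_right])
      have e1 : p + p' + x - (q + (len K (-v) + 1) • rot v) = p - (len K (-u) + 1) • rot u := by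
        rw [hx]; abel
      have e2 : p - (len K (-u) + 1) • rot u - x = q' + (len K (-v) + 1) • rot (-v) := by
        rw [hx, eq_sub_of_add_eq hκ, rot_neg, smul_neg]; abel
      rw [e1]
      exact Finset.mem_filter.2 ⟨hC, e2 ▸ hC'⟩
    · rw [dot_add_left, dot_add_left, dot_smul_left, dot_smul_left, dot_rot_left]
      have := hn.2.1
      linarith
  rw [h.covariogram_eq] at hlt
  exact lt_irrefl _ hlt

end IsSwitch

/-! ### Determination by the edge lengths -/

section determination

variable {K L V : Finset (ℤ × ℤ)} {e D : ℤ} {u v : ℤ × ℤ}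

/-- Translating `L` makes the vertices after the edge `u` coincide. Vertex differences and the equal
chains then force the other three marked vertices to coincide, and the symmetry of the chain gives
`p + p' = q + q'`. -/
theorem not_switch_of_lt_of_lt (hK : IsLatticePolygon K) (hL : IsLatticePolygon L)
    (hKV : HasLongEdges V e D K) (hLV : HasLongEdges V e D L) (hg : covariogram K = covariogram L)
    (hu : Int.gcd u.1 u.2 = 1) (hv : Int.gcd v.1 v.2 = 1) (huv : 0 < det u v)
    (hu₁ : len K u = len L u) (hu₂ : len K (-u) = len L (-u)) (hlu : len K (-u) < len K u)
    (hv₁ : len L v = len K (-v)) (hv₂ : len L (-v) = len K v) (hlv : len K (-v) < len K v)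
    (hb : ∀ w ∈ V, 0 < det u w → 0 < det w v →
      len K w = len K (-w) ∧ len L w = len K w ∧ len L (-w) = len K w) : False := by
  obtain ⟨p, hp⟩ := exists_isLast hK.nonempty u
  obtain ⟨b, hb0⟩ := exists_isLast hL.nonempty u
  have hL' := hL.shift (p - b)
  have hg' : covariogram K = covariogram (shift (p - b) L) := by rw [covariogram_shift, hg]
  have hbp := hb0.shift (p - b)
  rw [add_sub_cancel] at hbp
  obtain ⟨p', hp'⟩ := exists_isLast hK.nonempty (-u)
  obtain ⟨b', hb'⟩ := exists_isLast hL'.nonempty (-u)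
  have e1 : p' = b' :=
    sub_right_injective (last_sub_last_eq hg' (ne_zero_of_gcd hu) hp hp' hbp hb')
  subst e1
  obtain ⟨q, hq⟩ := exists_isFirst hK.nonempty v
  obtain ⟨q₁, hq₁⟩ := exists_isFirst hL'.nonempty v
  obtain ⟨q', hq'⟩ := exists_isFirst hK.nonempty (-v)
  obtain ⟨q₂, hq₂⟩ := exists_isFirst hL'.nonempty (-v)
  have hLV' := hLV.shift (p - b)
  have e2 := chain_eq hK hL' hKV.gcd_eq_one hKV.mem hLV'.mem huv
    (fun x hx h1 h2 => by rw [len_shift]; exact (hb x hx h1 h2).2.1.symm) hp hq hbp hq₁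
  have e3 := first_sub_first_eq hg' (ne_zero_of_gcd hv) hq hq' hq₁ hq₂
  have e4 := chain_eq hK hK.neg hKV.gcd_eq_one hKV.mem hKV.neg.mem huv
    (fun x hx h1 h2 => by rw [len_neg]; exact (hb x hx h1 h2).1) hp hq
    (by simpa using hp'.neg) (by simpa using hq'.neg)
  have e5 : q = q₁ := sub_left_injective e2
  subst e5
  have e6 : q' = q₂ := sub_right_injective e3
  subst e6
  have e7 : p + p' = q + q' := by
    have : q + q' = p + p' + (q - p - (-q' - -p')) := by abel
    rw [this, e4, sub_self, add_zero]
  exact IsSwitch.elim (K := K) (L := shift (p - b) L) (V := V) (e := e) (D := D)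
    { polygon_left := hK, polygon_right := hL', long_left := hKV, long_right := hLV'
      covariogram_eq := hg', gcd_left := hu, gcd_right := hv, det_pos := huv
      len_left := by rw [len_shift, hu₁]
      len_neg_left := by rw [len_shift, hu₂]
      lt_left := hlu
      len_right := by rw [len_shift, hv₁]
      len_neg_right := by rw [len_shift, hv₂]
      lt_right := hlv
      between := fun w hw h1 h2 => by rw [len_shift, len_shift]; exact hb w hw h1 h2
      last_left := hp, last_left' := hbp, last_neg_left := hp', last_neg_left' := hb'
      first_right := hq, first_right' := hq₁, first_neg_right := hq', first_neg_right' := hq₂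
      add_eq := e7 }

/-- Exchanging `K` and `L` reverses the inequality at `v` and preserves the one at `u`. -/
theorem not_switch_of_lt (hK : IsLatticePolygon K) (hL : IsLatticePolygon L)
    (hKV : HasLongEdges V e D K) (hLV : HasLongEdges V e D L) (hg : covariogram K = covariogram L)
    (hu : Int.gcd u.1 u.2 = 1) (hv : Int.gcd v.1 v.2 = 1) (huv : 0 < det u v)
    (hu₁ : len K u = len L u) (hu₂ : len K (-u) = len L (-u)) (hlu : len K (-u) < len K u)
    (hv₁ : len L v = len K (-v)) (hv₂ : len L (-v) = len K v) (hlv : len K (-v) ≠ len K v)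
    (hb : ∀ w ∈ V, 0 < det u w → 0 < det w v →
      len K w = len K (-w) ∧ len L w = len K w ∧ len L (-w) = len K w) : False := by
  rcases lt_or_gt_of_ne hlv with h | h
  · exact not_switch_of_lt_of_lt hK hL hKV hLV hg hu hv huv hu₁ hu₂ hlu hv₁ hv₂ h hb
  · refine not_switch_of_lt_of_lt hL hK hLV hKV hg.symm hu hv huv hu₁.symm hu₂.symm
      (by rwa [← hu₁, ← hu₂]) hv₂.symm hv₁.symm (by rwa [hv₁, hv₂]) fun w hw h1 h2 => ?_
    obtain ⟨h3, h4, h5⟩ := hb w hw h1 h2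
    exact ⟨h4.trans h5.symm, h4.symm, by rw [← h3, h4]⟩

/-- Replacing `u` and `v` by their negatives reverses the inequality at `u` and preserves the
orientation and the symmetric middle part. -/
theorem not_switch (hK : IsLatticePolygon K) (hL : IsLatticePolygon L)
    (hKV : HasLongEdges V e D K) (hLV : HasLongEdges V e D L) (hg : covariogram K = covariogram L)
    (hu : Int.gcd u.1 u.2 = 1) (hv : Int.gcd v.1 v.2 = 1) (huv : 0 < det u v)
    (hu₁ : len K u = len L u) (hu₂ : len K (-u) = len L (-u)) (hlu : len K (-u) ≠ len K u)
    (hv₁ : len L v = len K (-v)) (hv₂ : len L (-v) = len K v) (hlv : len K (-v) ≠ len K v)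
    (hb : ∀ w ∈ V, 0 < det u w → 0 < det w v →
      len K w = len K (-w) ∧ len L w = len K w ∧ len L (-w) = len K w) : False := by
  rcases lt_or_gt_of_ne hlu with h | h
  · exact not_switch_of_lt hK hL hKV hLV hg hu hv huv hu₁ hu₂ h hv₁ hv₂ hlv hb
  · refine not_switch_of_lt (u := -u) (v := -v) hK hL hKV hLV hg (gcd_neg hu) (gcd_neg hv)
      (by rwa [det_neg_left, det_neg_right, neg_neg]) hu₂ (by rwa [neg_neg]) (by rwa [neg_neg])
      (by rwa [neg_neg]) (by rwa [neg_neg]) (by rw [neg_neg]; exact hlv.symm) fun w hw h1 h2 => ?_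
    obtain ⟨h3, h4, h5⟩ := hb (-w) (hKV.neg_mem w hw) (by rwa [det_neg_right, ← det_neg_left])
      (by rwa [det_neg_left, ← det_neg_right])
    rw [neg_neg] at h3 h5
    exact ⟨h3.symm, h5.trans h3, h4.trans h3⟩

/-- Either all edge lengths of `K` and `L` agree, or they agree after a point reflection. -/
theorem forall_len_eq_or_forall_len_eq (hK : IsLatticePolygon K) (hL : IsLatticePolygon L)
    (hKV : HasLongEdges V e D K) (hLV : HasLongEdges V e D L)
    (hg : covariogram K = covariogram L) :
    (∀ w ∈ V, len K w = len L w) ∨ ∀ w ∈ V, len K w = len L (-w) := by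
  by_contra hcon
  push Not at hcon
  obtain ⟨⟨a, ha, hanot⟩, b, hb, hbnot⟩ := hcon
  have hcase := fun w (hw : w ∈ V) => len_eq_or_eq hK hL hg (hKV.gcd_eq_one w hw)
  -- A kept and a reversed unequal pair exist; changing the sign of one direction, if necessary,
  -- makes the determinant positive. The pair with the fewest directions in between is then used.
  have hex : ∃ n : ℕ, ∃ u ∈ V, ∃ v ∈ V, 0 < det u v ∧ len K u ≠ len L (-u) ∧
      len K v ≠ len L v ∧ (V.filter fun w => 0 < det u w ∧ 0 < det w v).card = n := by
    rcases lt_trichotomy (det b a) 0 with h | h | h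
    · refine ⟨_, b, hb, -a, hKV.neg_mem a ha, by rw [det_neg_right]; linarith, hbnot, ?_, rfl⟩
      rcases hcase a ha with h1 | h1
      · exact absurd h1.1 hanot
      · rw [h1.2, ← h1.1]; exact hanot.symm
    · exfalso
      rcases eq_or_eq_neg_of_det_eq_zero (hKV.gcd_eq_one b hb) (hKV.gcd_eq_one a ha) h with e | e
      · rw [e] at hanot
        rcases hcase b hb with h1 | h1
        · exact hanot h1.1
        · exact hbnot h1.1
      · rw [e] at hanot
        rcases hcase b hb with h1 | h1
        · exact hanot h1.2
        · exact hbnot h1.1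
    · exact ⟨_, b, hb, a, ha, h, hbnot, hanot, rfl⟩
  classical
  obtain ⟨u, hu, v, hv, huv, hune, hvne, hcard⟩ := Nat.find_spec hex
  have hmin := fun k (hk : k < Nat.find hex) => Nat.find_min hex hk
  rw [← hcard] at hmin
  obtain ⟨hu1, hu2⟩ := (hcase u hu).resolve_right fun h => hune h.1
  obtain ⟨hv1, hv2⟩ := (hcase v hv).resolve_left fun h => hvne h.1
  refine not_switch hK hL hKV hLV hg (hKV.gcd_eq_one u hu) (hKV.gcd_eq_one v hv) huv hu1 hu2
    (by rw [hu2]; exact hune.symm) hv2.symm hv1.symm (by rw [hv2]; exact hvne.symm)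
    fun w hw huw hwv => ?_
  have hwmem : w ∈ V.filter fun w => 0 < det u w ∧ 0 < det w v :=
    Finset.mem_filter.2 ⟨hw, huw, hwv⟩
  -- If this failed, `w` could replace `v`; if the next equality failed, `w` could replace `u`.
  -- Either would give a smaller sector.
  have h1 : len K w = len L w := by
    by_contra hne
    refine hmin _ (Finset.card_lt_card ((Finset.ssubset_iff_of_subset ?_).2
      ⟨w, hwmem, ?_⟩)) ⟨u, hu, w, hw, huw, hune, hne, rfl⟩
    · intro x hx
      obtain ⟨hx, h1, h2⟩ := Finset.mem_filter.1 hx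
      exact Finset.mem_filter.2 ⟨hx, h1, det_pos_of_between_of_between huv huw hwv h1 h2⟩
    · simp [det_self]
  have h2 : len K w = len L (-w) := by
    by_contra hne
    refine hmin _ (Finset.card_lt_card ((Finset.ssubset_iff_of_subset ?_).2
      ⟨w, hwmem, ?_⟩)) ⟨w, hw, v, hv, hwv, hne, hvne, rfl⟩
    · intro x hx
      obtain ⟨hx, h1, h2⟩ := Finset.mem_filter.1 hx
      exact Finset.mem_filter.2 ⟨hx, det_pos_of_between hwv h1 h2.le huw huv, h2⟩
    · simp [det_self]
  refine ⟨?_, h1.symm, h2.symm⟩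
  rcases hcase w hw with h3 | h3
  · rw [h3.2, h2]
  · rw [h3.2, h1]

/-- Every edge normal of `L` is reached from `u` or from `-u` by a chain of less than a half-turn.
Equal lengths make the chains of `K` and `L` end at the same vertex, so each half-plane of `L`
contains `K`. -/
theorem subset_of_forall_len_eq (hK : IsLatticePolygon K) (hL : IsLatticePolygon L)
    (hKV : HasLongEdges V e D K) (hLV : HasLongEdges V e D L) (hg : covariogram K = covariogram L)
    (h : ∀ w ∈ V, len K w = len L w) {p : ℤ × ℤ} (hu : Int.gcd u.1 u.2 = 1)
    (hp : IsLast K u p) (hp' : IsLast L u p) : K ⊆ L := by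
  intro z hz
  obtain ⟨b, hb⟩ := exists_isLast hK.nonempty (-u)
  obtain ⟨c, hc⟩ := exists_isLast hL.nonempty (-u)
  have e1 : b = c := sub_right_injective (last_sub_last_eq hg (ne_zero_of_gcd hu) hp hb hp' hc)
  subst e1
  refine hL.mem_of_forall_edge fun w hw => ?_
  have key : ∀ {u p}, 0 < det u w → IsLast K u p → IsLast L u p →
      ∃ p ∈ L, dot z w ≤ dot p w := by
    intro u p huw hp hp'
    obtain ⟨q, hq⟩ := exists_isFirst hK.nonempty w
    obtain ⟨q', hq'⟩ := exists_isFirst hL.nonempty w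
    have := chain_eq hK hL hKV.gcd_eq_one hKV.mem hLV.mem huw (fun x hx _ _ => h x hx) hp hq hp' hq'
    have e2 : q = q' := sub_left_injective this
    exact ⟨q, e2 ▸ hq'.mem, hq.dot_le hz⟩
  rcases lt_trichotomy (det u w) 0 with h1 | h1 | h1
  · exact key (by rw [det_neg_left]; linarith) hb hc
  · rcases eq_or_eq_neg_of_det_eq_zero hu hw.2.1 h1 with rfl | rfl
    · exact ⟨p, hp'.mem, hp.dot_le hz⟩
    · exact ⟨b, hc.mem, hb.dot_le hz⟩
  · exact key h1 hp hp'

theorem exists_shift_eq (hK : IsLatticePolygon K) (hL : IsLatticePolygon L)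
    (hKV : HasLongEdges V e D K) (hLV : HasLongEdges V e D L) (hg : covariogram K = covariogram L)
    (h : ∀ w ∈ V, len K w = len L w) : ∃ t, shift t K = L := by
  have hu : Int.gcd ((1, 0) : ℤ × ℤ).1 ((1, 0) : ℤ × ℤ).2 = 1 := by simp
  obtain ⟨p, hp⟩ := exists_isLast hK.nonempty (1, 0)
  obtain ⟨q, hq⟩ := exists_isLast hL.nonempty (1, 0)
  have hp' := hp.shift (q - p)
  rw [add_sub_cancel] at hp'
  have hg' : covariogram (shift (q - p) K) = covariogram L := by rw [covariogram_shift, hg]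
  have h' : ∀ w ∈ V, len (shift (q - p) K) w = len L w := fun w hw => by rw [len_shift, h w hw]
  exact ⟨q - p, (subset_of_forall_len_eq (hK.shift _) hL (hKV.shift _) hLV hg' h' hu hp'
    hq).antisymm (subset_of_forall_len_eq hL (hK.shift _) hLV (hKV.shift _) hg'.symm
    (fun w hw => (h' w hw).symm) hu hq hp')⟩

theorem exists_shift_eq_or_exists_shift_neg_eq (hK : IsLatticePolygon K) (hL : IsLatticePolygon L)
    (hKV : HasLongEdges V e D K) (hLV : HasLongEdges V e D L)
    (hg : covariogram K = covariogram L) : ∃ t, shift t K = L ∨ shift t (-K) = L := by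
  rcases forall_len_eq_or_forall_len_eq hK hL hKV hLV hg with h | h
  · obtain ⟨t, ht⟩ := exists_shift_eq hK hL hKV hLV hg h
    exact ⟨t, Or.inl ht⟩
  · obtain ⟨t, ht⟩ := exists_shift_eq hK.neg hL hKV.neg hLV (by rw [covariogram_neg, hg])
      fun w hw => by rw [len_neg, h _ (hKV.neg_mem w hw), neg_neg]
    exact ⟨t, Or.inr ht⟩

end determination

/-! ### Lattice-convex sets -/

/-- A point outside is separated from the convex hull by a real functional; a large multiple of it,
rounded to integer coefficients, still separates. -/
theorem IsLatticeConvex.mem_of_forall {K : Finset (ℤ × ℤ)} (hK : IsLatticeConvex K) {z : ℤ × ℤ}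
    (h : ∀ u : ℤ × ℤ, ∃ y ∈ K, dot z u ≤ dot y u) : z ∈ K := by
  obtain ⟨C, hC, hCK⟩ := hK
  by_contra hz
  have hsub : convexHull ℝ (toReal '' (K : Set (ℤ × ℤ))) ⊆ C :=
    convexHull_min (by rintro _ ⟨y, hy, rfl⟩; exact (hCK y).1 hy) hC
  have hcl : IsClosed (convexHull ℝ (toReal '' (K : Set (ℤ × ℤ)))) :=
    (K.finite_toSet.image toReal).isClosed_convexHull ℝ
  obtain ⟨f, s, hf, hs⟩ := geometric_hahn_banach_closed_point (convex_convexHull ℝ _) hcl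
    fun hmem => hz ((hCK z).2 (hsub hmem))
  have hfe : ∀ x : ℤ × ℤ, f (toReal x) = x.1 * f (1, 0) + x.2 * f (0, 1) := fun x => by
    have : toReal x = (x.1 : ℝ) • ((1, 0) : ℝ × ℝ) + (x.2 : ℝ) • ((0, 1) : ℝ × ℝ) := by
      simp [toReal]
    rw [this, map_add, map_smul, map_smul, smul_eq_mul, smul_eq_mul]
  set M : ℝ := ∑ y ∈ K, (|(y.1 : ℝ) - z.1| + |(y.2 : ℝ) - z.2|)
  -- After scaling by `N` the separation gap exceeds `M`, which bounds the total effect of rounding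
  -- the two coefficients.
  obtain ⟨N, hN⟩ := exists_nat_gt (M / (f (toReal z) - s))
  rw [div_lt_iff₀ (by linarith)] at hN
  obtain ⟨y, hy, hle⟩ := h (round (N * f (1, 0)), round (N * f (0, 1)))
  have hfy := hf (toReal y) (subset_convexHull ℝ _ ⟨y, hy, rfl⟩)
  have hM : |(y.1 : ℝ) - z.1| + |(y.2 : ℝ) - z.2| ≤ M :=
    Finset.single_le_sum (f := fun y : ℤ × ℤ => |(y.1 : ℝ) - z.1| + |(y.2 : ℝ) - z.2|)
      (fun _ _ => by positivity) hy
  have hle' : (z.1 : ℝ) * round (N * f (1, 0)) + z.2 * round (N * f (0, 1)) ≤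
      y.1 * round (N * f (1, 0)) + y.2 * round (N * f (0, 1)) := by
    simp only [dot] at hle
    exact_mod_cast hle
  have hround : ∀ a b : ℝ, a * (round b - b) ≤ |a| := fun a b => by
    have h1 := abs_sub_round b
    rw [abs_sub_comm] at h1
    calc a * (round b - b) ≤ |a * (round b - b)| := le_abs_self _
      _ = |a| * |round b - b| := abs_mul _ _
      _ ≤ |a| * 1 := mul_le_mul_of_nonneg_left (by linarith) (abs_nonneg a)
      _ = |a| := mul_one _
  have h1 := hround (y.1 - z.1) (N * f (1, 0))
  have h2 := hround (y.2 - z.2) (N * f (0, 1))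
  have h3 : (N : ℝ) * f (toReal y) ≤ N * s := mul_le_mul_of_nonneg_left hfy.le (Nat.cast_nonneg N)
  rw [hfe] at h3 hN
  linarith

theorem IsPlanarLatticeConvex.isLatticePolygon {K : Finset (ℤ × ℤ)}
    (hK : IsPlanarLatticeConvex K) : IsLatticePolygon K where
  mem_of_forall z h := hK.latticeConvex.mem_of_forall h
  exists_dot_lt u hu := by
    by_contra hcon
    push Not at hcon
    let φ : ℝ × ℝ →ₗ[ℝ] ℝ :=
      (u.1 : ℝ) • LinearMap.fst ℝ ℝ ℝ + (u.2 : ℝ) • LinearMap.snd ℝ ℝ ℝ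
    have hφ : ∀ x : ℤ × ℤ, φ (toReal x) = dot x u := fun x => by
      simp [φ, toReal, dot, mul_comm]
    have hne : (toReal '' (K : Set (ℤ × ℤ))).Nonempty := by
      rw [← affineSpan_nonempty ℝ, hK.affineSpan_eq_top]
      exact Set.univ_nonempty
    obtain ⟨_, p, hp, rfl⟩ := hne
    have hle : affineSpan ℝ (toReal '' (K : Set (ℤ × ℤ))) ≤
        AffineSubspace.mk' (toReal p) (LinearMap.ker φ) := by
      rw [affineSpan_le]
      rintro _ ⟨y, hy, rfl⟩
      rw [SetLike.mem_coe, AffineSubspace.mem_mk', LinearMap.mem_ker, vsub_eq_sub, map_sub, hφ, hφ,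
        sub_eq_zero, Int.cast_inj]
      exact le_antisymm (hcon p hp y hy) (hcon y hy p hp)
    have hmem : toReal p + toReal u ∈ AffineSubspace.mk' (toReal p) (LinearMap.ker φ) :=
      hle (by rw [hK.affineSpan_eq_top]; exact AffineSubspace.mem_top ℝ _ _)
    rw [AffineSubspace.mem_mk', LinearMap.mem_ker, vsub_eq_sub, add_sub_cancel_left, hφ] at hmem
    exact (dot_self_pos hu).ne' (by exact_mod_cast hmem)

/-! ### Quantities determined by the covariogram -/

section invariants

variable {K L : Finset (ℤ × ℤ)}

theorem card_supportSet_eq_or_eq (hK : IsLatticePolygon K) (hL : IsLatticePolygon L)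
    (hg : covariogram K = covariogram L) {u : ℤ × ℤ} (hu : u ≠ 0) :
    ((supportSet K u).card = (supportSet L u).card ∧
        (supportSet K (-u)).card = (supportSet L (-u)).card) ∨
      ((supportSet K u).card = (supportSet L (-u)).card ∧
        (supportSet K (-u)).card = (supportSet L u).card) := by
  obtain ⟨k, v, hk, rfl, hv⟩ := exists_primitive hu
  rw [← smul_neg]
  simp only [supportSet_smul hk]
  have := len_eq_or_eq hK hL hg hv
  unfold len at this
  omega

theorem mPrime_le (hK : IsLatticePolygon K) (hL : IsLatticePolygon L)
    (hg : covariogram K = covariogram L) : mPrime K ≤ mPrime L := by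
  refine sInf_le_sInf ?_
  rintro n ⟨u, hu, rfl⟩
  rcases card_supportSet_eq_or_eq hL hK hg.symm hu.1 with h | h
  · exact ⟨u, ⟨hu.1, hu.2.1, h.1 ▸ hu.2.2⟩, by rw [h.1]⟩
  · exact ⟨-u, ⟨neg_ne_zero.2 hu.1, gcd_neg hu.2.1, h.1 ▸ hu.2.2⟩, by rw [h.1]⟩

theorem mDoublePrime_le (hK : IsLatticePolygon K) (hL : IsLatticePolygon L)
    (hg : covariogram K = covariogram L) : mDoublePrime K ≤ mDoublePrime L := by
  refine sInf_le_sInf ?_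
  rintro n ⟨u, hu, hlt, h1, rfl⟩
  rcases card_supportSet_eq_or_eq hL hK hg.symm hu with h | h
  · rw [h.1, h.2] at hlt ⊢
    rw [h.2] at h1
    exact ⟨u, hu, hlt, h1, rfl⟩
  · rw [h.1, h.2] at hlt ⊢
    rw [h.2] at h1
    exact ⟨-u, neg_ne_zero.2 hu, by rwa [neg_neg], by rwa [neg_neg], by rw [neg_neg]⟩

theorem edgeNormals_union_subset (hK : IsLatticePolygon K) (hL : IsLatticePolygon L)
    (hg : covariogram K = covariogram L) :
    edgeNormals K ∪ edgeNormals (-K) ⊆ edgeNormals L ∪ edgeNormals (-L) := by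
  intro u hu
  have hprim : Int.gcd u.1 u.2 = 1 := hu.elim (fun h => h.2.1) fun h => h.2.1
  simp only [Set.mem_union, mem_edgeNormals, len_neg] at hu ⊢
  rcases len_eq_or_eq hK hL hg hprim with ⟨h1, h2⟩ | ⟨h1, h2⟩
  · rwa [← h1, ← h2]
  · rw [← h1, ← h2]; exact hu.symm

theorem edgeNormals_union_eq (hK : IsLatticePolygon K) (hL : IsLatticePolygon L)
    (hg : covariogram K = covariogram L) :
    edgeNormals K ∪ edgeNormals (-K) = edgeNormals L ∪ edgeNormals (-L) :=
  (edgeNormals_union_subset hK hL hg).antisymm (edgeNormals_union_subset hL hK hg.symm)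

/-- Signs do not affect absolute determinants. So the discrepancy depends only on `U(K) ∪ U(-K)`,
which the covariogram determines. -/
theorem detSet_union (K : Finset (ℤ × ℤ)) :
    detSet (edgeNormals K ∪ edgeNormals (-K)) = detSet (edgeNormals K) := by
  have key : ∀ w ∈ edgeNormals K ∪ edgeNormals (-K), ∃ w' ∈ edgeNormals K, w = w' ∨ w = -w' := by
    rintro w (h | h)
    · exact ⟨w, h, Or.inl rfl⟩
    · exact ⟨-w, mem_edgeNormals_neg.1 h, Or.inr (neg_neg w).symm⟩
  refine Set.Subset.antisymm ?_ ?_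
  · rintro n ⟨hn, u, hu, v, hv, rfl⟩
    obtain ⟨u', hu', hu⟩ := key u hu
    obtain ⟨v', hv', hv⟩ := key v hv
    refine ⟨hn, u', hu', v', hv', ?_⟩
    rcases hu with rfl | rfl <;> rcases hv with rfl | rfl <;>
      simp only [det_neg_left, det_neg_right, Int.natAbs_neg]
  · rintro n ⟨hn, u, hu, v, hv, rfl⟩
    exact ⟨hn, u, Or.inl hu, v, Or.inl hv, rfl⟩

theorem detSet_edgeNormals_eq (hK : IsLatticePolygon K) (hL : IsLatticePolygon L)
    (hg : covariogram K = covariogram L) :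
    detSet (edgeNormals K) = detSet (edgeNormals L) := by
  rw [← detSet_union, edgeNormals_union_eq hK hL hg, detSet_union]

end invariants

/-! ### From the bound on `m` to long edges -/

theorem detSet_finite {U : Set (ℤ × ℤ)} (hU : U.Finite) : (detSet U).Finite := by
  refine ((hU.prod hU).image fun x => (det x.1 x.2).natAbs).subset ?_
  rintro n ⟨-, u, hu, v, hv, rfl⟩
  exact ⟨(u, v), ⟨hu, hv⟩, rfl⟩

theorem IsLatticePolygon.detSet_nonempty {K : Finset (ℤ × ℤ)} (hK : IsLatticePolygon K) :
    (detSet (edgeNormals K)).Nonempty := by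
  obtain ⟨u, hu, -⟩ := exists_edgeNormal_det_pos hK (u := (1, 0)) (by simp)
  obtain ⟨v, hv, h⟩ := exists_edgeNormal_det_pos hK hu.1
  exact ⟨_, Int.natAbs_ne_zero.2 h.ne', u, hu, v, hv, rfl⟩

theorem mul_le_of_discrepancy_le {D e n : ℕ} (he : 0 < e)
    (h : ((D : ℝ≥0) / (e : ℝ≥0)) ^ 2 + (D : ℝ≥0) / (e : ℝ≥0) + 1 ≤ ((n + 1 : ℕ) : ℝ≥0)) :
    (D : ℤ) * (D + e) ≤ n * (e : ℤ) ^ 2 := by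
  have h1 : ((D : ℝ) / e) ^ 2 + (D : ℝ) / e + 1 ≤ n + 1 := by exact_mod_cast h
  have he' : (0 : ℝ) < e := by exact_mod_cast he
  have h2 : ((D : ℝ) / e) ^ 2 + (D : ℝ) / e = (D * (D + e)) / (e : ℝ) ^ 2 := by
    field_simp
  have h3 : ((D : ℝ) * (D + e)) / (e : ℝ) ^ 2 ≤ n := by rw [← h2]; linarith
  rw [div_le_iff₀ (by positivity)] at h3
  exact_mod_cast h3

theorem IsLatticePolygon.hasLongEdges {K V : Finset (ℤ × ℤ)} (hK : IsLatticePolygon K)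
    (hV : (V : Set (ℤ × ℤ)) = edgeNormals K ∪ edgeNormals (-K))
    (hm : ((discrepancy K ^ 2 + discrepancy K + 1 : ℝ≥0) : ℝ≥0∞) ≤ (m K : ℝ≥0∞)) :
    HasLongEdges V (sInf (detSet (edgeNormals K)) : ℕ) (sSup (detSet (edgeNormals K)) : ℕ) K := by
  have hmem : ∀ w, w ∈ V ↔ w ∈ edgeNormals K ∨ -w ∈ edgeNormals K := fun w => by
    rw [← Finset.mem_coe, hV, Set.mem_union, mem_edgeNormals_neg]
  have hinf := Nat.sInf_mem hK.detSet_nonempty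
  have hpos : 0 < sInf (detSet (edgeNormals K)) := Nat.pos_of_ne_zero hinf.1
  have hdet : ∀ v ∈ V, ∀ w ∈ V, det v w ≠ 0 → (det v w).natAbs ∈ detSet (edgeNormals K) :=
    fun v hv w hw h => by
      rw [← detSet_union, ← hV]
      exact ⟨Int.natAbs_ne_zero.2 h, v, hv, w, hw, rfl⟩
  -- The summand 1 in the bound on `m` is the difference between the number of lattice points and
  -- the lattice length.
  have hle : ∀ n : ℕ, m K ≤ ((n + 1 : ℕ) : ℕ∞) →
      ((sSup (detSet (edgeNormals K)) : ℕ) : ℤ) *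
        ((sSup (detSet (edgeNormals K)) : ℕ) + (sInf (detSet (edgeNormals K)) : ℕ)) ≤
      n * ((sInf (detSet (edgeNormals K)) : ℕ) : ℤ) ^ 2 := fun n hn => by
    refine mul_le_of_discrepancy_le hpos ?_
    have h1 := hm.trans (ENat.toENNReal_le.2 hn)
    rw [ENat.toENNReal_coe] at h1
    exact_mod_cast h1
  have hlen : ∀ w ∈ edgeNormals K, ((sSup (detSet (edgeNormals K)) : ℕ) : ℤ) *
        ((sSup (detSet (edgeNormals K)) : ℕ) + (sInf (detSet (edgeNormals K)) : ℕ)) ≤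
      len K w * ((sInf (detSet (edgeNormals K)) : ℕ) : ℤ) ^ 2 := fun w hw => by
    have hc := hw.2.2
    have h1 := hle ((supportSet K w).card - 1) <| (min_le_left _ _).trans <|
      sInf_le ⟨w, hw, by rw [Nat.sub_add_cancel hc.le]⟩
    rwa [Nat.cast_sub hc.le, Nat.cast_one] at h1
  refine ⟨by exact_mod_cast hpos, fun w hw => ?_, fun w hw => ?_, fun v hv w hw h => ?_,
    fun v hv w hw => ?_, fun w hw => (hmem w).2 (Or.inl hw), hlen, fun w hw hlt => ?_⟩
  · rcases (hmem w).1 hw with h | h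
    · exact h.2.1
    · have := gcd_neg h.2.1
      rwa [neg_neg] at this
  · rw [hmem, neg_neg]
    exact ((hmem w).1 hw).symm
  · have := Nat.sInf_le (hdet v hv w hw h.ne')
    omega
  · rcases eq_or_ne (det v w) 0 with h | h
    · rw [h]; positivity
    · have := le_csSup (detSet_finite (edgeNormals_finite K)).bddAbove (hdet v hv w hw h)
      omega
  -- If the opposite face is a vertex, then `m''` says nothing, but the difference is the full
  -- length of the edge, which `m'` controls.
  · rcases (len_nonneg hK (u := -w)).eq_or_lt with h | h
    · rw [← h, sub_zero]
      exact hlen w hw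
    · rw [len_pos_iff] at h
      have hlt' : (supportSet K (-w)).card < (supportSet K w).card := by
        unfold len at hlt; omega
      have h1 := hle ((supportSet K w).card - (supportSet K (-w)).card) <|
        (min_le_right _ _).trans <| sInf_le ⟨w, hw.1, hlt', h, rfl⟩
      rw [Nat.cast_sub hlt'.le] at h1
      unfold len
      rwa [sub_sub_sub_cancel_right]

/-! ### Classes of translates and reflections -/

theorem translationReflectionClass_subset {S T : Set (ℝ × ℝ)}
    (h : T ∈ translationReflectionClass S) :
    translationReflectionClass T ⊆ translationReflectionClass S := by
  rcases h with ⟨t, rfl⟩ | ⟨t, rfl⟩ <;> rintro R (⟨s, rfl⟩ | ⟨s, rfl⟩)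
  · refine Or.inl ⟨t + s, ?_⟩
    rw [Set.image_image]
    exact Set.image_congr fun x _ => by abel
  · refine Or.inr ⟨-t + s, ?_⟩
    rw [Set.image_image]
    exact Set.image_congr fun x _ => by abel
  · refine Or.inr ⟨t + s, ?_⟩
    rw [Set.image_image]
    exact Set.image_congr fun x _ => by abel
  · refine Or.inl ⟨-t + s, ?_⟩
    rw [Set.image_image]
    exact Set.image_congr fun x _ => by abel

theorem mem_translationReflectionClass_symm {S T : Set (ℝ × ℝ)}
    (h : T ∈ translationReflectionClass S) : S ∈ translationReflectionClass T := by
  rcases h with ⟨t, rfl⟩ | ⟨t, rfl⟩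
  · exact Or.inl ⟨-t, by rw [Set.image_image]; simp⟩
  · exact Or.inr ⟨t, by rw [Set.image_image]; simp⟩

theorem translationReflectionClass_eq {S T : Set (ℝ × ℝ)}
    (h : T ∈ translationReflectionClass S) :
    translationReflectionClass S = translationReflectionClass T :=
  (translationReflectionClass_subset (mem_translationReflectionClass_symm h)).antisymm
    (translationReflectionClass_subset h)

theorem toReal_image_shift (K : Finset (ℤ × ℤ)) (t : ℤ × ℤ) :
    toReal '' (shift t K : Set (ℤ × ℤ)) =
      (fun x => x + toReal t) '' (toReal '' (K : Set (ℤ × ℤ))) := by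
  rw [shift, Finset.coe_image, Set.image_image, Set.image_image]
  exact Set.image_congr fun x _ => by simp [toReal]

theorem toReal_image_shift_neg (K : Finset (ℤ × ℤ)) (t : ℤ × ℤ) :
    toReal '' (shift t (-K) : Set (ℤ × ℤ)) =
      (fun x => -x + toReal t) '' (toReal '' (K : Set (ℤ × ℤ))) := by
  rw [toReal_image_shift, Finset.coe_neg, ← Set.image_neg_eq_neg, Set.image_image, Set.image_image,
    Set.image_image]
  exact Set.image_congr fun x _ => by simp [toReal]

end LatticeCovariogram

/-! ### The theorem -/

open LatticeCovariogram in
theorem theorem1 (K L : Finset (ℤ × ℤ))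
    (hK : IsPlanarLatticeConvex K) (hL : IsPlanarLatticeConvex L)
    (hg : covariogram K = covariogram L) :
    (mPrime K = mPrime L ∧
      mDoublePrime K = mDoublePrime L ∧
      m K = m L ∧
      edgeNormals K ∪ edgeNormals (-K) = edgeNormals L ∪ edgeNormals (-L) ∧
      discrepancy K = discrepancy L) ∧
    (((discrepancy K ^ 2 + discrepancy K + 1 : ℝ≥0) : ℝ≥0∞) ≤ (m K : ℝ≥0∞) →
      translationReflectionClass (toReal '' (K : Set (ℤ × ℤ))) =
        translationReflectionClass (toReal '' (L : Set (ℤ × ℤ)))) := by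
  have hK' := hK.isLatticePolygon
  have hL' := hL.isLatticePolygon
  have h1 : mPrime K = mPrime L := (mPrime_le hK' hL' hg).antisymm (mPrime_le hL' hK' hg.symm)
  have h2 : mDoublePrime K = mDoublePrime L :=
    (mDoublePrime_le hK' hL' hg).antisymm (mDoublePrime_le hL' hK' hg.symm)
  have h3 : m K = m L := by rw [m, m, h1, h2]
  have h4 := edgeNormals_union_eq hK' hL' hg
  have h5 := detSet_edgeNormals_eq hK' hL' hg
  have h6 : discrepancy K = discrepancy L := by
    rw [discrepancy, discrepancy, setDiscrepancy, setDiscrepancy, h5]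
  refine ⟨⟨h1, h2, h3, h4, h6⟩, fun hm => translationReflectionClass_eq ?_⟩
  have hfin := (edgeNormals_finite K).union (edgeNormals_finite (-K))
  -- Both polygons must have long edges for the same `V`, `e` and `D`; this is possible because
  -- `U(K) ∪ U(-K)` and the set of determinants are invariants.
  have hKV := hK'.hasLongEdges (V := hfin.toFinset) hfin.coe_toFinset hm
  rw [h6, h3] at hm
  have hLV := hL'.hasLongEdges (V := hfin.toFinset) (hfin.coe_toFinset.trans h4) hm
  rw [← h5] at hLV
  obtain ⟨t, rfl | rfl⟩ := exists_shift_eq_or_exists_shift_neg_eq hK' hL' hKV hLV hg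
  · exact Or.inl ⟨_, toReal_image_shift K t⟩
  · exact Or.inr ⟨_, toReal_image_shift_neg K t⟩
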